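/- **Definitions.** Let $p(t,x|x')=(2\pi t)^{-1/2}e^{-(x-x')^2/2t}$, $h_N(\boldsymbol x)=\prod_{1\le j<k\le N}(x_k-x_j)$ and $f_N(t,\boldsymbol y|\boldsymbol x)=\det_{1\le j,k\le N}[p(t,y_j|x_k)]$. The noncolliding Brownian motion of $N$ particles is the Markov process on the Weyl chamber $\{x_1<\dots<x_N\}$ with transition density $$p_N(t,\boldsymbol y|\boldsymbol x)=\frac{h_N(\boldsymbol y)}{h_N(\boldsymbol x)}f_N(t,\boldsymbol y|\boldsymbol x).$$ It is started at time $t_0>0$ from the GUE eigenvalue density of variance $t_0$, $$\nu_0(\boldsymbol x)=\frac1{C_N}\,t_0^{-N^2/2}e^{-|\boldsymbol x|^2/2t_0}h_N(\boldsymbol x)^2,\qquad C_N=(2\pi)^{N/2}\prod_{j=1}^N\Gamma(j).$$ For $t_0<t_1<\dots<t_M$ its multitime density, regarded as a function of $\boldsymbol x^{(0)},\dots,\boldsymbol x^{(M)}\in\mathbb R^N$ that is symmetric in the coordinates of each $\boldsymbol x^{(m)}$, is $$\mathfrak p_N(t_0,\boldsymbol x^{(0)};\dots;t_M,\boldsymbol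 x^{(M)})=\nu_0(\boldsymbol x^{(0)})\prod_{m=0}^{M-1}p_N(t_{m+1}-t_m,\boldsymbol x^{(m+1)}|\boldsymbol x^{(m)}),$$ with the factors $p_N(\cdot,\cdot|\boldsymbol x)$ set to $0$ when two coordinates of $\boldsymbol x$ coincide. For positive integers $N_0,\dots,N_M\le N$ and $\boldsymbol x^{(m)}_{N_m}=(x^{(m)}_1,\dots,x^{(m)}_{N_m})$, the $(N_0,\dots,N_M)$-multitime correlation function is $$\rho_N(t_0,\boldsymbol x^{(0)}_{N_0};\dots;t_M,\boldsymbol x^{(M)}_{N_M})=\int_{\prod_{m}\mathbb R^{N-N_m}}\mathfrak p_N(t_0,\boldsymbol x^{(0)};\dots;t_M,\boldsymbol x^{(M)})\prod_{m=0}^M\frac1{(N-N_m)!}\prod_{j=N_m+1}^N dx^{(m)}_j .$$ **Theorem.** Let $M\ge 0$, let $N_0,\dots,N_M$ be positive integers, let $0=s_0<s_1<\dots<s_M$, and let $\boldsymbol x^{(m)}_{N_m}\in\mathbb R^{N_m}$ for $0\le m\le M$. Then for every $N\ge\max_m N_m$ the integral defining $\rho_N$ at the times $t_m=N+2s_m$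 converges absolutely, and $$\lim_{N\to\infty}\rho_N\bigl(N,\boldsymbol x^{(0)}_{N_0};N+2s_1,\boldsymbol x^{(1)}_{N_1};\dots;N+2s_M,\boldsymbol x^{(M)}_{N_M}\bigr)=\det_{\substack{1\le j\le N_m,\ 1\le k\le N_n\\ 0\le m,n\le M}}\Bigl[\boldsymbol K\bigl(s_m,x^{(m)}_j;s_n,x^{(n)}_k\bigr)\Bigr],$$ where $\boldsymbol K$ is the extended sine kernel $$\boldsymbol K(t,y;s,x)=\begin{cases}\dfrac1\pi\displaystyle\int_0^1 e^{(s-t)u^2}\cos(u(y-x))\,du,& t<s,\\[2mm] \dfrac{\sin(y-x)}{\pi(y-x)}\quad\bigl(=\tfrac1\pi\text{ if }y=x\bigr),& t=s,\\[2mm] -\dfrac1\pi\displaystyle\int_1^\infty e^{-(t-s)u^2}\cos(u(y-x))\,du,& t>s.\end{cases}$$ -/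

import Mathlib

open MeasureTheory

namespace NoncollidingBM

/-- The heat kernel `p(t, x | x')`, transition density of one-dimensional standard Brownian
motion. -/
noncomputable def heatKernel (t x x' : ℝ) : ℝ :=
  1 / Real.sqrt (2 * Real.pi * t) * Real.exp (-(x - x') ^ 2 / (2 * t))

/-- The Karlin-McGregor determinant `f_N(t, y | x) = det [p(t, y_j | x_k)]`, which on the Weyl
chamber is the transition density of Brownian motion absorbed at the walls of the chamber. -/
noncomputable def karlinMcGregor {N : ℕ} (t : ℝ) (y x : Fin N → ℝ) : ℝ :=
  (Matrix.of fun j k : Fin N => heatKernel t (y j) (x k)).det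

/-- The product of differences `h_N(x) = ∏_{j < k} (x_k - x_j)`. -/
noncomputable def vandermonde {N : ℕ} (x : Fin N → ℝ) : ℝ :=
  ∏ j : Fin N, ∏ k ∈ Finset.Ioi j, (x k - x j)

/-- Transition density `p_N(t, y | x)` of the (temporally homogeneous) noncolliding Brownian
motion: the `h_N`-transform of absorbing Brownian motion in the Weyl chamber. The formula is
invariant under separate permutations of the coordinates of `x` and of `y`, so on all of `ℝ^N` it
is the symmetric extension of the density on the Weyl chamber; when two coordinates of `x`
coincide its value is `0`. -/
noncomputable def transitionDensity {N : ℕ} (t : ℝ) (y x : Fin N → ℝ) : ℝ :=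
  vandermonde y / vandermonde x * karlinMcGregor t y x

/-- The normalizing constant `C_N = (2π)^{N/2} ∏_{j=1}^N Γ(j)`. -/
noncomputable def gueConst (N : ℕ) : ℝ :=
  (2 * Real.pi) ^ ((N : ℝ) / 2) * ∏ j ∈ Finset.Icc 1 N, Real.Gamma (j : ℝ)

/-- The GUE eigenvalue density with variance `t`, normalized on the Weyl chamber (and extended
symmetrically to `ℝ^N`). -/
noncomputable def gueDensity {N : ℕ} (t : ℝ) (x : Fin N → ℝ) : ℝ :=
  1 / gueConst N * t ^ (-((N : ℝ) ^ 2 / 2)) *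
    Real.exp (-(∑ j, x j ^ 2) / (2 * t)) * vandermonde x ^ 2

/-- Multitime probability density at the times `t_0 < t_1 < ⋯ < t_M` of the noncolliding Brownian
motion started at time `t_0` from the GUE eigenvalue distribution with variance `t_0`.
Here `x m` is the configuration at time `t m`. -/
noncomputable def multitimeDensity {M N : ℕ} (t : Fin (M + 1) → ℝ)
    (x : Fin (M + 1) → Fin N → ℝ) : ℝ :=
  (∏ m : Fin M, transitionDensity (t m.succ - t m.castSucc) (x m.succ) (x m.castSucc)) *
    gueDensity (t 0) (x 0)

/-- The vector `(x_1, …, x_n, y_1, …, y_{N-n}) ∈ ℝ^N` (used for `n ≤ N`). -/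
def append {n N : ℕ} (x : Fin n → ℝ) (y : Fin (N - n) → ℝ) : Fin N → ℝ :=
  fun i => if h : (i : ℕ) < n then x ⟨i, h⟩ else y ⟨i - n, by omega⟩

/-- The `(n_0, …, n_M)`-multitime correlation function `ρ_N(t_0, x 0; …; t_M, x M)` (for
`n_m ≤ N`): at each time `t_m` the last `N - n_m` coordinates of the multitime density are
integrated out over the whole line, with the factor `1 / (N - n_m)!`. -/
noncomputable def corr (N : ℕ) {M : ℕ} (n : Fin (M + 1) → ℕ) (t : Fin (M + 1) → ℝ)
    (x : (m : Fin (M + 1)) → Fin (n m) → ℝ) : ℝ :=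
  ∫ y : (m : Fin (M + 1)) → Fin (N - n m) → ℝ,
    multitimeDensity t (fun m => append (x m) (y m)) *
      ∏ m, (1 / ((N - n m).factorial : ℝ))

/-- The extended sine kernel `K(t, y; s, x)`. On the diagonal `t = s` it is
`sin (y - x) / (π (y - x))`, with the value `1 / π` at `y = x`. -/
noncomputable def sineKernel (t y s x : ℝ) : ℝ :=
  if t < s then
    1 / Real.pi * ∫ u in (0 : ℝ)..1, Real.exp ((s - t) * u ^ 2) * Real.cos (u * (y - x))
  else if t = s then
    Real.sinc (y - x) / Real.pi
  else
    -(1 / Real.pi) *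
      ∫ u in Set.Ioi (1 : ℝ), Real.exp (-(t - s) * u ^ 2) * Real.cos (u * (y - x))

end NoncollidingBM

/-!
# The scaling limit of noncolliding Brownian motion started from the GUE

At finite `N` the multitime correlation functions are determinants of the extended Hermite kernel
`corrKernel N t y s x = ∑_{k < N} F_k(t, y) B_k(s, x) - 1_{s < t} p(t - s, y | x)`. Here `B_k(s, ·)`
(`heatPoly`) is the monic Hermite polynomial for variance `s`, which the heat semigroup carries
backwards in time, and `F_k(t, ·) = (-∂)^k p(t, · | 0) / k!` (`heatDual`), carried forwards by the
semigroup, is its dual basis.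

*Determinantal structure.* When all `N` particles are present at every time, the matrix of
`corrKernel` is `F B - Φ` with `Φ` strictly block triangular. Written as a Schur complement, its
determinant becomes block triangular after a cyclic shift of the block rows
(`det_fromBlocks_cyclic`) and is the product of the Karlin-McGregor determinants with
`det B = h_N` at the last time and `det F = h_N` times a Gaussian weight at the first time, which
is the multitime density
(`det_corrMatrix_eq_multitimeDensity`). A kernel with a subtracted `Φ` is not reproducing, but
`∫ K(a; r, z) K(r, z; b) dz = (1_{r ≤ b} - 1_{r < a}) K(a; b)`
(`integratesTo_corrKernel_mul_corrKernel`). Expanding a bordered determinant along its border, one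
finds that integrating out one particle at time `r` multiplies the determinant by
`N - #{particles fixed at time r}` (`integratesTo_det_corrMatrix`). Iterating this produces exactly
the factorials in the definition of `corr`. Fubini's theorem applies because the density is
dominated by a product of Gaussians (`exists_bound_multitimeDensity`).

*Asymptotics.* Writing `F_k` as a Fourier integral, the sum in the kernel is
`(2π)⁻¹ ∫ G_N(u) exp(-iuy - t u² / 2) du`, where `G_N` is the truncation after `N` terms of the
generating series `∑ B_k(s, x) (iu)^k / k! = exp(iux + s u² / 2)`. All terms of this series are
dominated by those of the series with `|x|` and `-s`, whose sum is explicit. With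
`s = N + O(1)` this shows that `exp(-s u² / 2) G_N(u)` is within a constant multiple of
`(|u| exp((1 - u²) / 2))^N` of `exp(iux)` if `|u| < 1` and of `0` if `|u| > 1`, and it also supplies
an integrable majorant. Dominated convergence leaves an integral over `[-1, 1]`
(`tendsto_heatProj`), and subtracting the heat kernel, which is the same integral over the whole
line, gives the extended sine kernel (`tendsto_corrKernel`).
-/

namespace NoncollidingBM

/-! ### Integrals on the line -/

/-- `f` is integrable on the line and its integral is `v`. -/
def IntegratesTo (f : ℝ → ℝ) (v : ℝ) : Prop := Integrable f ∧ ∫ z, f z = v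

namespace IntegratesTo
variable {f g : ℝ → ℝ} {v w : ℝ}

lemma add (hf : IntegratesTo f v) (hg : IntegratesTo g w) :
    IntegratesTo (fun z => f z + g z) (v + w) :=
  ⟨hf.1.add hg.1, by rw [integral_add hf.1 hg.1, hf.2, hg.2]⟩

lemma sub (hf : IntegratesTo f v) (hg : IntegratesTo g w) :
    IntegratesTo (fun z => f z - g z) (v - w) :=
  ⟨hf.1.sub hg.1, by rw [integral_sub hf.1 hg.1, hf.2, hg.2]⟩

lemma const_mul (c : ℝ) (hf : IntegratesTo f v) : IntegratesTo (fun z => c * f z) (c * v) :=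
  ⟨hf.1.const_mul c, by rw [integral_const_mul, hf.2]⟩

lemma sum {ι : Type*} (s : Finset ι) {f : ι → ℝ → ℝ} {v : ι → ℝ}
    (h : ∀ i ∈ s, IntegratesTo (f i) (v i)) :
    IntegratesTo (fun z => ∑ i ∈ s, f i z) (∑ i ∈ s, v i) :=
  ⟨integrable_finsetSum s fun i hi => (h i hi).1, by
    rw [integral_finsetSum s fun i hi => (h i hi).1]
    exact Finset.sum_congr rfl fun i hi => (h i hi).2⟩

lemma congr (hf : IntegratesTo f v) (h : ∀ z, g z = f z) (hv : w = v) : IntegratesTo g w := by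
  obtain rfl : g = f := funext h
  rwa [hv]

end IntegratesTo

/-! ### The heat kernel -/

lemma integrable_eval_mul_heatKernel {t : ℝ} (ht : 0 < t) (P : Polynomial ℝ) (μ : ℝ) :
    Integrable fun z => P.eval z * heatKernel t z μ := by
  have key : ∀ Q : Polynomial ℝ, Integrable fun z => Q.eval z * heatKernel t z 0 := by
    intro Q
    have : (fun z => Q.eval z * heatKernel t z 0) = fun z =>
        ∑ i ∈ Finset.range (Q.natDegree + 1), (Q.coeff i * (1 / Real.sqrt (2 * Real.pi * t))) *
          (z ^ (i : ℝ) * Real.exp (-(1 / (2 * t)) * z ^ 2)) := by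
      funext z
      rw [Polynomial.eval_eq_sum_range, Finset.sum_mul]
      refine Finset.sum_congr rfl fun i _ => ?_
      unfold heatKernel
      rw [Real.rpow_natCast, show -(z - 0) ^ 2 / (2 * t) = -(1 / (2 * t)) * z ^ 2 by ring]
      ring
    rw [this]
    refine integrable_finsetSum _ fun i _ => Integrable.const_mul ?_ _
    refine integrable_rpow_mul_exp_neg_mul_sq (by positivity) ?_
    have : (0 : ℝ) ≤ i := Nat.cast_nonneg i
    linarith
  have h := (key (P.comp (Polynomial.X + Polynomial.C μ))).comp_sub_right μ
  refine h.congr (Filter.Eventually.of_forall fun z => ?_)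
  simp [heatKernel]

lemma integrable_heatKernel {t : ℝ} (ht : 0 < t) (μ : ℝ) :
    Integrable fun z => heatKernel t z μ := by
  simpa using integrable_eval_mul_heatKernel ht 1 μ

lemma integral_heatKernel {t : ℝ} (ht : 0 < t) (μ : ℝ) : ∫ z, heatKernel t z μ = 1 := by
  have h := integral_sub_right_eq_self (fun z => heatKernel t z 0) μ (μ := volume)
  have h2 : ∀ z, heatKernel t (z - μ) 0 = heatKernel t z μ := fun z => by simp [heatKernel]
  simp only [h2] at h
  rw [h]
  unfold heatKernel
  rw [integral_const_mul]
  have : ∀ z : ℝ, -(z - 0) ^ 2 / (2 * t) = -(1 / (2 * t)) * z ^ 2 := fun z => by ring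
  simp only [this]
  rw [integral_gaussian, show Real.pi / (1 / (2 * t)) = 2 * Real.pi * t by field_simp]
  have : Real.sqrt (2 * Real.pi * t) ≠ 0 := by positivity
  field_simp

lemma hasDerivAt_heatKernel {t : ℝ} (ht : 0 < t) (μ z : ℝ) :
    HasDerivAt (fun z => heatKernel t z μ) (-((z - μ) / t) * heatKernel t z μ) z := by
  unfold heatKernel
  have h1 : HasDerivAt (fun z : ℝ => -(z - μ) ^ 2 / (2 * t)) (-((z - μ) / t)) z := by
    have := ((((hasDerivAt_id z).sub_const μ).pow 2).neg).div_const (2 * t)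
    refine this.congr_deriv ?_
    simp
    field_simp
  refine (h1.exp.const_mul _).congr_deriv ?_
  ring

/-- Gaussian integration by parts. -/
lemma integral_stein {t : ℝ} (ht : 0 < t) (P : Polynomial ℝ) (μ : ℝ) :
    ∫ z, z * P.eval z * heatKernel t z μ =
      μ * (∫ z, P.eval z * heatKernel t z μ) +
        t * ∫ z, (Polynomial.derivative P).eval z * heatKernel t z μ := by
  have hP := integrable_eval_mul_heatKernel ht P μ
  have hP' := integrable_eval_mul_heatKernel ht (Polynomial.derivative P) μ
  have hXP := integrable_eval_mul_heatKernel ht (Polynomial.X * P) μ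
  simp only [Polynomial.eval_mul, Polynomial.eval_X] at hXP
  have h0 := integral_eq_zero_of_hasDerivAt_of_integrable
    (f := fun z => P.eval z * heatKernel t z μ)
    (f' := fun z => (Polynomial.derivative P).eval z * heatKernel t z μ -
      (1 / t * (z * P.eval z * heatKernel t z μ) - μ / t * (P.eval z * heatKernel t z μ)))
    (fun z => ((P.hasDerivAt z).mul (hasDerivAt_heatKernel ht μ z)).congr_deriv (by ring))
    (hP'.sub ((hXP.const_mul _).sub (hP.const_mul _))) hP
  have h1 := ((show IntegratesTo _ _ from ⟨hP', rfl⟩).sub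
    (((show IntegratesTo _ _ from ⟨hXP, rfl⟩).const_mul (1 / t)).sub
      ((show IntegratesTo _ _ from ⟨hP, rfl⟩).const_mul (μ / t)))).2
  rw [h0] at h1
  field_simp at h1
  linarith

/-- Bayes' rule for Gaussians: given its values at both ends, an intermediate point of a Brownian
path is Gaussian. -/
lemma heatKernel_mul_heatKernel {t τ : ℝ} (ht : 0 < t) (hτ : 0 < τ) (x y z : ℝ) :
    heatKernel t z x * heatKernel τ y z =
      heatKernel (t + τ) y x *
        heatKernel (t * τ / (t + τ)) z ((τ * x + t * y) / (t + τ)) := by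
  unfold heatKernel
  have hs : 0 < t + τ := by positivity
  have e : ∀ a b c d : ℝ, 1 / a * Real.exp b * (1 / c * Real.exp d) =
      1 / (a * c) * Real.exp (b + d) := by
    intro a b c d; rw [Real.exp_add]; ring
  rw [e, e, ← Real.sqrt_mul (by positivity), ← Real.sqrt_mul (by positivity)]
  congr 2
  · congr 1
    field_simp
  · field_simp
    ring

/-! ### Heat polynomials -/

open Polynomial in
/-- The monic Hermite polynomial of degree `k` for the Gaussian weight of variance `t`. -/
noncomputable def heatPoly (t : ℝ) : ℕ → Polynomial ℝ
  | 0 => 1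
  | k + 1 => X * heatPoly t k - C t * derivative (heatPoly t k)

lemma derivative_heatPoly (t : ℝ) (k : ℕ) :
    Polynomial.derivative (heatPoly t (k + 1)) = Polynomial.C ((k : ℝ) + 1) * heatPoly t k := by
  induction k with
  | zero => simp [heatPoly]
  | succ k ih =>
    have h2 : heatPoly t (k + 1 + 1) = Polynomial.X * heatPoly t (k + 1) -
        Polynomial.C t * Polynomial.derivative (heatPoly t (k + 1)) := rfl
    have h1 : heatPoly t (k + 1) = Polynomial.X * heatPoly t k -
        Polynomial.C t * Polynomial.derivative (heatPoly t k) := rfl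
    rw [h2, ih]
    simp only [Polynomial.derivative_sub, Polynomial.derivative_mul, Polynomial.derivative_X,
      Polynomial.derivative_C, ih, zero_mul, zero_add, one_mul]
    rw [h1]
    push_cast
    simp only [Polynomial.C_add, Polynomial.C_1]
    ring

lemma eval_heatPoly_zero (t x : ℝ) : (heatPoly t 0).eval x = 1 := by simp [heatPoly]

lemma eval_heatPoly_one (t x : ℝ) : (heatPoly t 1).eval x = x := by simp [heatPoly]

lemma eval_heatPoly_succ_succ (t x : ℝ) (k : ℕ) :
    (heatPoly t (k + 2)).eval x =
      x * (heatPoly t (k + 1)).eval x - t * (k + 1) * (heatPoly t k).eval x := by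
  have h2 : heatPoly t (k + 2) = Polynomial.X * heatPoly t (k + 1) -
        Polynomial.C t * Polynomial.derivative (heatPoly t (k + 1)) := rfl
  rw [h2, derivative_heatPoly]
  simp
  ring

lemma natDegree_heatPoly_le (t : ℝ) (k : ℕ) : (heatPoly t k).natDegree ≤ k := by
  induction k with
  | zero => simp [heatPoly]
  | succ k ih =>
    refine (Polynomial.natDegree_sub_le _ _).trans (max_le ?_ ?_)
    · refine (Polynomial.natDegree_mul_le).trans ?_
      have := Polynomial.natDegree_X_le (R := ℝ)
      omega
    · refine (Polynomial.natDegree_C_mul_le _ _).trans ?_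
      have := Polynomial.natDegree_derivative_le (heatPoly t k)
      omega

lemma coeff_heatPoly (t : ℝ) (k : ℕ) : (heatPoly t k).coeff k = 1 := by
  induction k with
  | zero => simp [heatPoly]
  | succ k ih =>
    have h : (heatPoly t k).coeff (k + 1 + 1) = 0 :=
      Polynomial.coeff_eq_zero_of_natDegree_lt (by have := natDegree_heatPoly_le t k; omega)
    simp [heatPoly, Polynomial.coeff_derivative, ih, h]

lemma natDegree_heatPoly (t : ℝ) (k : ℕ) : (heatPoly t k).natDegree = k :=
  le_antisymm (natDegree_heatPoly_le t k)
    (Polynomial.le_natDegree_of_ne_zero (by simp [coeff_heatPoly]))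

lemma monic_heatPoly (t : ℝ) (k : ℕ) : (heatPoly t k).Monic := by
  rw [Polynomial.Monic, Polynomial.leadingCoeff, natDegree_heatPoly, coeff_heatPoly]

lemma eval_heatPoly_mul (c t x : ℝ) (k : ℕ) :
    (heatPoly (c ^ 2 * t) k).eval (c * x) = c ^ k * (heatPoly t k).eval x := by
  induction k using Nat.twoStepInduction with
  | zero => simp [eval_heatPoly_zero]
  | one => simp [eval_heatPoly_one]
  | more k h0 h1 =>
    rw [eval_heatPoly_succ_succ, eval_heatPoly_succ_succ, h0, h1]
    ring

/-- The heat semigroup runs the heat polynomials backwards in time. -/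
lemma integral_heatPoly_mul_heatKernel {t τ T : ℝ} (hτ : 0 < τ) (hT : t + τ = T) (μ : ℝ) (k : ℕ) :
    ∫ z, (heatPoly T k).eval z * heatKernel τ z μ = (heatPoly t k).eval μ := by
  induction k using Nat.twoStepInduction with
  | zero => simp [eval_heatPoly_zero, integral_heatKernel hτ]
  | one =>
    have := integral_stein hτ 1 μ
    simpa [eval_heatPoly_one, integral_heatKernel hτ] using this
  | more k h0 h1 =>
    have hs := integral_stein hτ (heatPoly T (k + 1)) μ
    have i1 := integrable_eval_mul_heatKernel hτ (Polynomial.X * heatPoly T (k + 1)) μ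
    have i0 := integrable_eval_mul_heatKernel hτ (heatPoly T k) μ
    simp only [Polynomial.eval_mul, Polynomial.eval_X] at i1
    rw [derivative_heatPoly] at hs
    simp only [Polynomial.eval_mul, Polynomial.eval_C, mul_assoc, integral_const_mul] at hs
    simp only [eval_heatPoly_succ_succ, sub_mul, mul_assoc] at *
    rw [integral_sub i1 ((i0.const_mul _).const_mul _), integral_const_mul, integral_const_mul,
      hs, h0, h1, ← hT]
    ring

/-- Orthogonality of the heat polynomials. -/
lemma integral_heatPoly_mul_heatPoly {t : ℝ} (ht : 0 < t) (j k : ℕ) :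
    ∫ z, (heatPoly t j).eval z * (heatPoly t k).eval z * heatKernel t z 0 =
      if j = k then (k.factorial : ℝ) * t ^ k else 0 := by
  have step : ∀ j k : ℕ,
      ∫ z, (heatPoly t j).eval z * (heatPoly t (k + 1)).eval z * heatKernel t z 0 =
      t * ∫ z, (Polynomial.derivative (heatPoly t j)).eval z * (heatPoly t k).eval z *
        heatKernel t z 0 := by
    intro j k
    have hs := integral_stein ht (heatPoly t j * heatPoly t k) 0
    have i1 := integrable_eval_mul_heatKernel ht (Polynomial.X * (heatPoly t j * heatPoly t k)) 0
    have i2 := integrable_eval_mul_heatKernel ht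
      (heatPoly t j * Polynomial.derivative (heatPoly t k)) 0
    have i3 := integrable_eval_mul_heatKernel ht
      (Polynomial.derivative (heatPoly t j) * heatPoly t k) 0
    simp only [Polynomial.derivative_mul, Polynomial.eval_mul, Polynomial.eval_X,
      Polynomial.eval_add, zero_mul, zero_add, add_mul] at hs i1 i2 i3
    rw [integral_add i3 i2] at hs
    have : ∀ z, (heatPoly t j).eval z * (heatPoly t (k + 1)).eval z * heatKernel t z 0 =
        z * ((heatPoly t j).eval z * (heatPoly t k).eval z) * heatKernel t z 0 -
        t * ((heatPoly t j).eval z * (Polynomial.derivative (heatPoly t k)).eval z *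
          heatKernel t z 0) := by
      intro z
      simp only [heatPoly, Polynomial.eval_sub, Polynomial.eval_mul, Polynomial.eval_X,
        Polynomial.eval_C]
      ring
    simp only [this]
    rw [integral_sub i1 (i2.const_mul _), integral_const_mul, hs]
    ring
  induction k generalizing j with
  | zero =>
    cases j with
    | zero => simp [eval_heatPoly_zero, integral_heatKernel ht]
    | succ j =>
      have := step 0 j
      simpa [eval_heatPoly_zero, heatPoly, mul_comm] using this
  | succ k ih =>
    rw [step]
    cases j with
    | zero => simp [heatPoly]
    | succ j =>
      have h := ih j
      simp only [derivative_heatPoly, Polynomial.eval_mul, Polynomial.eval_C, mul_assoc,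
        integral_const_mul] at h ⊢
      rw [h]
      by_cases hjk : j = k
      · subst hjk
        simp [Nat.factorial_succ]
        ring
      · simp [hjk]

/-- The functions `y ↦ (-∂_y)^k p(t, y | 0) / k!`, which are dual to the heat polynomials. -/
noncomputable def heatDual (t : ℝ) (k : ℕ) (y : ℝ) : ℝ :=
  (heatPoly t k).eval y * heatKernel t y 0 / (k.factorial * t ^ k)

lemma integratesTo_heatDual_mul_heatPoly {t : ℝ} (ht : 0 < t) (j k : ℕ) :
    IntegratesTo (fun z => heatDual t j z * (heatPoly t k).eval z) (if j = k then 1 else 0) := by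
  have h : IntegratesTo (fun z => (heatPoly t j).eval z * (heatPoly t k).eval z *
      heatKernel t z 0) (if j = k then (k.factorial : ℝ) * t ^ k else 0) := by
    refine ⟨?_, integral_heatPoly_mul_heatPoly ht j k⟩
    simpa using integrable_eval_mul_heatKernel ht (heatPoly t j * heatPoly t k) 0
  refine (h.const_mul (1 / (j.factorial * t ^ j))).congr (fun z => ?_) ?_
  · unfold heatDual; ring
  · by_cases hjk : j = k
    · subst hjk
      have : (j.factorial : ℝ) ≠ 0 := by positivity
      simp
      field_simp
    · simp [hjk]

lemma integratesTo_heatPoly_mul_heatKernel {s t : ℝ} (h : s < t) (x : ℝ) (k : ℕ) :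
    IntegratesTo (fun z => (heatPoly t k).eval z * heatKernel (t - s) z x)
      ((heatPoly s k).eval x) :=
  ⟨integrable_eval_mul_heatKernel (sub_pos.2 h) _ _,
    integral_heatPoly_mul_heatKernel (sub_pos.2 h) (by ring) x k⟩

lemma integratesTo_heatKernel_mul_heatKernel {r s t : ℝ} (h : r < s) (h' : s < t) (x y : ℝ) :
    IntegratesTo (fun z => heatKernel (t - s) y z * heatKernel (s - r) z x)
      (heatKernel (t - r) y x) := by
  have h1 : 0 < s - r := by linarith
  have h2 : 0 < t - s := by linarith
  have h3 : 0 < (s - r) * (t - s) / ((s - r) + (t - s)) := by positivity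
  have : IntegratesTo (fun z => heatKernel ((s - r) * (t - s) / ((s - r) + (t - s))) z
      (((t - s) * x + (s - r) * y) / ((s - r) + (t - s)))) 1 :=
    ⟨integrable_heatKernel h3 _, integral_heatKernel h3 _⟩
  refine (this.const_mul (heatKernel (t - r) y x)).congr (fun z => ?_) (by ring)
  rw [mul_comm, heatKernel_mul_heatKernel h1 h2]
  congr 2
  ring

/-- The heat semigroup carries the dual functions forwards in time. -/
lemma integratesTo_heatKernel_mul_heatDual {s t : ℝ} (hs : 0 < s) (h : s < t) (y : ℝ) (k : ℕ) :
    IntegratesTo (fun z => heatKernel (t - s) y z * heatDual s k z) (heatDual t k y) := by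
  have h2 : 0 < t - s := by linarith
  have ht : 0 < t := by linarith
  have h3 : 0 < s * (t - s) / t := by positivity
  -- conditionally on the value `y` at time `t`, the value at time `s` has mean `s / t * y`
  have : IntegratesTo (fun z => (heatPoly s k).eval z * heatKernel (s * (t - s) / t) z
      (s / t * y)) ((s / t) ^ k * (heatPoly t k).eval y) := by
    refine ⟨integrable_eval_mul_heatKernel h3 _ _, ?_⟩
    rw [integral_heatPoly_mul_heatKernel (t := (s / t) ^ 2 * t) h3 (by field_simp; ring),
      eval_heatPoly_mul]
  refine (this.const_mul (heatKernel t y 0 / (k.factorial * s ^ k))).congr (fun z => ?_) ?_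
  · have := heatKernel_mul_heatKernel hs h2 0 y z
    rw [show s + (t - s) = t by ring, show ((t - s) * 0 + s * y) / t = s / t * y by ring] at this
    have e : heatKernel (t - s) y z * heatDual s k z = (heatPoly s k).eval z *
        (heatKernel s z 0 * heatKernel (t - s) y z) / (k.factorial * s ^ k) := by
      unfold heatDual; ring
    rw [e, this]
    ring
  · unfold heatDual
    rw [div_pow]
    field_simp

/-! ### The finite-`N` kernel and its composition rule -/

/-- The part of the correlation kernel that has rank `N`. -/
noncomputable def heatProj (N : ℕ) (t y s x : ℝ) : ℝ :=
  ∑ k ∈ Finset.range N, heatDual t k y * (heatPoly s k).eval x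

/-- The extended Hermite kernel, which is the correlation kernel of the `N`-particle system. -/
noncomputable def corrKernel (N : ℕ) (t y s x : ℝ) : ℝ :=
  heatProj N t y s x - if s < t then heatKernel (t - s) y x else 0

lemma integratesTo_heatProj_mul_heatProj (N : ℕ) {r : ℝ} (hr : 0 < r) (t y s x : ℝ) :
    IntegratesTo (fun z => heatProj N t y r z * heatProj N r z s x) (heatProj N t y s x) := by
  refine (IntegratesTo.sum (Finset.range N) (fun k _ => IntegratesTo.sum (Finset.range N)
    (fun j _ => (integratesTo_heatDual_mul_heatPoly hr j k).const_mul
      (heatDual t k y * (heatPoly s j).eval x)))).congr (fun z => ?_) ?_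
  · unfold heatProj
    rw [Finset.sum_mul_sum]
    refine Finset.sum_congr rfl fun k _ => Finset.sum_congr rfl fun j _ => by ring
  · unfold heatProj
    refine Finset.sum_congr rfl fun k hk => ?_
    rw [Finset.sum_eq_single_of_mem k hk (fun j _ hj => by simp [hj])]
    simp

lemma integratesTo_heatProj_mul_heatKernel (N : ℕ) {r s : ℝ} (h : s < r) (t y x : ℝ) :
    IntegratesTo (fun z => heatProj N t y r z * heatKernel (r - s) z x) (heatProj N t y s x) := by
  refine (IntegratesTo.sum (Finset.range N) (fun k _ =>
    (integratesTo_heatPoly_mul_heatKernel h x k).const_mul (heatDual t k y))).congr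
      (fun z => ?_) rfl
  rw [heatProj, Finset.sum_mul]
  exact Finset.sum_congr rfl fun k _ => by ring

lemma integratesTo_heatKernel_mul_heatProj (N : ℕ) {r t : ℝ} (hr : 0 < r) (h : r < t)
    (y s x : ℝ) :
    IntegratesTo (fun z => heatKernel (t - r) y z * heatProj N r z s x) (heatProj N t y s x) := by
  refine (IntegratesTo.sum (Finset.range N) (fun k _ =>
    (integratesTo_heatKernel_mul_heatDual hr h y k).const_mul ((heatPoly s k).eval x))).congr
      (fun z => ?_) ?_
  · rw [heatProj, Finset.mul_sum]
    exact Finset.sum_congr rfl fun k _ => by ring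
  · exact Finset.sum_congr rfl fun k _ => by ring

/-- The substitute for the reproducing property of a projection kernel: each of the two `heatProj`
and heat kernel parts composes to `heatProj` or the heat kernel again, and the signs collect as
stated according to the order of `t`, `r`, `s`. -/
lemma integratesTo_corrKernel_mul_corrKernel (N : ℕ) {r : ℝ} (hr : 0 < r) (t y s x : ℝ) :
    IntegratesTo (fun z => corrKernel N t y r z * corrKernel N r z s x)
      (((if r ≤ s then 1 else 0) - (if r < t then 1 else 0)) * corrKernel N t y s x) := by
  have h1 := integratesTo_heatProj_mul_heatProj N hr t y s x
  unfold corrKernel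
  by_cases hrs : r ≤ s
  · by_cases hrt : r < t
    · have h2 := integratesTo_heatKernel_mul_heatProj N hr hrt y s x
      refine (h1.sub h2).congr (fun z => ?_) ?_
      · simp only [hrs.not_gt, hrt, if_true, if_false]; ring
      · simp [hrs, hrt]
    · refine h1.congr (fun z => ?_) ?_
      · simp only [hrs.not_gt, hrt, if_false]; ring
      · have : ¬ s < t := by linarith
        simp [hrs, hrt, this]
  · have hsr : s < r := not_le.1 hrs
    have h3 := integratesTo_heatProj_mul_heatKernel N hsr t y x
    by_cases hrt : r < t
    · have h2 := integratesTo_heatKernel_mul_heatProj N hr hrt y s x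
      have h4 := integratesTo_heatKernel_mul_heatKernel hsr hrt x y
      refine ((h1.sub h2).sub (h3.sub h4)).congr (fun z => ?_) ?_
      · simp only [hsr, hrt, if_true]; ring
      · simp [hrs, hrt, hsr.trans hrt]
    · refine (h1.sub h3).congr (fun z => ?_) ?_
      · simp only [hsr, hrt, if_true, if_false]; ring
      · simp [hrs, hrt]

lemma integratesTo_corrKernel_diag (N : ℕ) {r : ℝ} (hr : 0 < r) :
    IntegratesTo (fun z => corrKernel N r z r z) N := by
  refine (IntegratesTo.sum (Finset.range N) (fun k _ =>
    integratesTo_heatDual_mul_heatPoly hr k k)).congr (fun z => ?_) ?_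
  · simp [corrKernel, heatProj]
  · simp

/-! ### Integrating one particle out of the determinant -/

section Bordered
open Matrix
variable {α R : Type*} [Fintype α] [DecidableEq α] [CommRing R]

/-- Expansion of a bordered determinant along its border. -/
lemma det_fromBlocks_border (A : Matrix α α R) (u v : α → R) (κ : R) :
    (fromBlocks A (of fun a (_ : Unit) => u a) (of fun (_ : Unit) b => v b)
      (of fun (_ _ : Unit) => κ)).det =
      κ * A.det - ∑ a, ∑ b, A.adjugate b a * (u a * v b) := by
  set M := fromBlocks A (of fun a (_ : Unit) => u a) (of fun (_ : Unit) b => v b)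
      (of fun (_ _ : Unit) => κ) with hM
  have h1 : M.adjugate (Sum.inr ()) (Sum.inr ()) = A.det := by
    rw [adjugate_apply]
    have : M.updateRow (Sum.inr ()) (Pi.single (Sum.inr ()) 1) =
        fromBlocks A (of fun a (_ : Unit) => u a) 0 1 := by
      ext i j
      rcases i with i | i <;> rcases j with j | j <;> simp [hM, updateRow_apply]
    rw [this, det_fromBlocks_zero₂₁]
    simp
  have h2 : ∀ b, M.adjugate (Sum.inl b) (Sum.inr ()) = -(A.updateCol b u).det := by
    intro b
    rw [adjugate_apply]
    -- exchanging the columns `b` and `()` makes the matrix block triangular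
    have hs := det_permute' (Equiv.swap (Sum.inl b) (Sum.inr ()))
      (M.updateRow (Sum.inr ()) (Pi.single (Sum.inl b) 1))
    rw [Equiv.Perm.sign_swap (by simp)] at hs
    have : (M.updateRow (Sum.inr ()) (Pi.single (Sum.inl b) 1)).submatrix id
        (Equiv.swap (Sum.inl b) (Sum.inr ())) =
        fromBlocks (A.updateCol b u) (of fun a (_ : Unit) => A a b) 0 1 := by
      ext i j
      rcases i with i | i <;> rcases j with j | j
      · by_cases hj : j = b
        · subst hj; simp [hM, updateRow_apply]
        · simp [hM, updateRow_apply, hj, Equiv.swap_apply_of_ne_of_ne]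
      · simp [hM, updateRow_apply]
      · by_cases hj : j = b
        · subst hj; simp [updateRow_apply]
        · simp [updateRow_apply, hj, Equiv.swap_apply_of_ne_of_ne]
      · simp [updateRow_apply]
    rw [this, det_fromBlocks_zero₂₁] at hs
    simp only [det_one, mul_one] at hs
    rw [hs]
    simp
  rw [det_eq_sum_mul_adjugate_row M (Sum.inr ())]
  simp only [Fintype.sum_sum_type, h1, h2, Finset.univ_unique, Finset.sum_singleton]
  have h3 : ∀ b, (A.updateCol b u).det = ∑ a, A.adjugate b a * u a := by
    intro b
    rw [← cramer_apply, cramer_eq_adjugate_mulVec]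
    rfl
  simp only [h3, hM, fromBlocks_apply₂₁, fromBlocks_apply₂₂, of_apply]
  rw [Finset.sum_comm, add_comm, sub_eq_add_neg, ← Finset.sum_neg_distrib]
  congr 1
  refine Finset.sum_congr rfl fun b _ => ?_
  rw [mul_neg, Finset.mul_sum]
  congr 1
  exact Finset.sum_congr rfl fun a _ => by ring

end Bordered

open Matrix in
/-- The matrix `K(T_a, x_a; T_b, x_b)` for particles with times `T` and positions `x`. -/
noncomputable def corrMatrix {α : Type*} (N : ℕ) (T x : α → ℝ) : Matrix α α ℝ :=
  of fun a b => corrKernel N (T a) (x a) (T b) (x b)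

/-- Integrating out one particle at time `r` multiplies the determinant by the number of particles
not yet fixed at that time. -/
lemma integratesTo_det_corrMatrix {α : Type*} [Fintype α] [DecidableEq α] (N : ℕ)
    (T x : α → ℝ) {r : ℝ} (hr : 0 < r) :
    IntegratesTo (fun z => (corrMatrix N (Sum.elim T fun _ : Unit => r)
        (Sum.elim x fun _ => z)).det)
      ((N - (Finset.univ.filter fun a => T a = r).card) * (corrMatrix N T x).det) := by
  set A := corrMatrix N T x with hA
  have h := ((integratesTo_corrKernel_diag N hr).const_mul A.det).sub
    (IntegratesTo.sum Finset.univ (fun a _ => IntegratesTo.sum Finset.univ (fun b _ =>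
      (integratesTo_corrKernel_mul_corrKernel N hr (T a) (x a) (T b) (x b)).const_mul
        (A.adjugate b a))))
  refine h.congr (fun z => ?_) ?_
  · rw [← mul_comm (corrKernel N r z r z), ← det_fromBlocks_border A
      (fun a => corrKernel N (T a) (x a) r z) (fun b => corrKernel N r z (T b) (x b))
      (corrKernel N r z r z)]
    congr 1
    ext i j
    rcases i with i | i <;> rcases j with j | j <;> simp [corrMatrix, hA]
  · have e1 : ∀ b, ∑ a, A.adjugate b a * A a b = A.det := fun b => by
      have := congrFun (congrFun (Matrix.adjugate_mul A) b) b
      simpa [Matrix.mul_apply] using this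
    have e2 : ∀ a, ∑ b, A.adjugate b a * A a b = A.det := fun a => by
      have := congrFun (congrFun (Matrix.mul_adjugate A) a) a
      simpa [Matrix.mul_apply, mul_comm] using this
    have e3 : ∀ a b, A.adjugate b a * (((if r ≤ T b then 1 else 0) - (if r < T a then 1 else 0)) *
        corrKernel N (T a) (x a) (T b) (x b)) = (if r ≤ T b then 1 else 0) *
          (A.adjugate b a * A a b) - (if r < T a then 1 else 0) * (A.adjugate b a * A a b) := by
      intro a b
      simp only [hA, corrMatrix, Matrix.of_apply]
      ring
    simp only [e3, Finset.sum_sub_distrib]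
    rw [Finset.sum_comm]
    simp only [← Finset.mul_sum, e1, e2]
    rw [← Finset.sum_mul, ← Finset.sum_mul, ← sub_mul, ← Finset.sum_sub_distrib]
    have e4 : ∀ a, ((if r ≤ T a then (1 : ℝ) else 0) - if r < T a then 1 else 0) =
        if T a = r then 1 else 0 := by
      intro a
      rcases lt_trichotomy (T a) r with h | h | h
      · simp [h.not_ge, h.not_gt, h.ne]
      · simp [h]
      · simp [h.le, h, h.ne']
    simp only [e4, Finset.sum_boole]
    ring

/-! ### The multitime density as a determinant -/

/-- Adjoining one more block of `N` indices in front of `M + 1` blocks. -/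
def consBlock (M N : ℕ) : Fin (M + 2) × Fin N ≃ Fin N ⊕ (Fin (M + 1) × Fin N) where
  toFun p := Fin.cases (Sum.inl p.2) (fun m => Sum.inr (m, p.2)) p.1
  invFun := Sum.elim (fun k => (0, k)) (fun q => (q.1.succ, q.2))
  left_inv p := by
    obtain ⟨r, k⟩ := p
    induction r using Fin.cases <;> simp
  right_inv q := by rcases q with q | q <;> simp

@[simp] lemma consBlock_zero (M N : ℕ) (k : Fin N) : consBlock M N (0, k) = Sum.inl k := rfl

@[simp] lemma consBlock_succ (M N : ℕ) (m : Fin (M + 1)) (k : Fin N) :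
    consBlock M N (m.succ, k) = Sum.inr (m, k) := rfl

section
open Matrix

/-- The determinant of a matrix which is block triangular after a cyclic shift of its block rows:
`D` vanishes in the blocks `(m, n)` with `m ≤ n`. -/
lemma det_fromBlocks_cyclic {R : Type*} [CommRing R] {M N : ℕ}
    (B : Matrix (Fin N) (Fin (M + 1) × Fin N) R) (F : Matrix (Fin (M + 1) × Fin N) (Fin N) R)
    (D : Matrix (Fin (M + 1) × Fin N) (Fin (M + 1) × Fin N) R)
    (hD : ∀ p q, p.1 ≤ q.1 → D p q = 0) :
    (fromBlocks 1 (-B) F (-D)).det =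
      (of fun j k => F (0, j) k).det *
        (∏ m : Fin M, (of fun j k => D (m.succ, j) (m.castSucc, k)).det) *
        (of fun j k => B j (Fin.last M, k)).det := by
  set L := (fromBlocks 1 (-B) F (-D)).submatrix (consBlock M N) (consBlock M N) with hL
  have hdet : (fromBlocks 1 (-B) F (-D)).det = L.det := (det_submatrix_equiv_self _ _).symm
  set σ : Equiv.Perm (Fin (M + 2) × Fin N) :=
    Equiv.prodCongrLeft (fun _ : Fin N => finRotate (M + 2)) with hσ
  have hcast : ∀ (m : Fin (M + 1)) (k : Fin N), σ (m.castSucc, k) = (m.succ, k) := by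
    intro m k
    simp [hσ, Equiv.prodCongrLeft]
  have hlast : ∀ k : Fin N, σ (Fin.last (M + 1), k) = (0, k) := by
    intro k
    simp [hσ, Equiv.prodCongrLeft]
  have hsign : ((Equiv.Perm.sign σ : ℤ) : R) = ((-1) ^ N) ^ (M + 1) := by
    rw [hσ, Equiv.Perm.sign_prodCongrLeft]
    simp [← pow_mul, mul_comm]
  have hperm := det_permute σ L
  have htri : (L.submatrix σ id)ᵀ.BlockTriangular Prod.fst := by
    rintro ⟨c, k⟩ ⟨r, j⟩ hrc
    simp only at hrc
    simp only [transpose_apply, submatrix_apply, id]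
    obtain ⟨r, rfl⟩ : ∃ r', r = Fin.castSucc r' :=
      ⟨r.castPred (ne_of_lt (lt_of_lt_of_le hrc (Fin.le_last c))), by simp⟩
    obtain ⟨c, rfl⟩ : ∃ c', c = Fin.succ c' :=
      ⟨c.pred (ne_of_gt (lt_of_le_of_lt (Fin.zero_le _) hrc)), by simp⟩
    rw [hcast]
    simp [hL, hD (r, j) (c, k) (by simpa using Fin.castSucc_lt_succ_iff.1 hrc)]
  have hblock : ∀ r : Fin (M + 2), ((L.submatrix σ id)ᵀ.toSquareBlock Prod.fst r).det =
      (of fun j k => L (σ (r, j)) (r, k)).det := by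
    intro r
    let e : Fin N ≃ {p : Fin (M + 2) × Fin N // p.1 = r} :=
      ⟨fun k => ⟨(r, k), rfl⟩, fun p => p.1.2, fun k => rfl, by rintro ⟨⟨a, b⟩, rfl⟩; rfl⟩
    rw [← det_submatrix_equiv_self e, ← det_transpose]
    rfl
  have hprod := htri.det_fintype
  rw [det_transpose, hperm, hsign, ← hdet] at hprod
  simp only [hblock] at hprod
  rw [Fin.prod_univ_castSucc, Fin.prod_univ_succ] at hprod
  have b0 : (of fun j k => L (σ ((0 : Fin (M + 1)).castSucc, j))
      ((0 : Fin (M + 1)).castSucc, k)) = of fun j k => F (0, j) k := by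
    ext j k
    simp only [of_apply, hcast, hL, submatrix_apply, consBlock_succ]
    simp
  have b1 : ∀ m : Fin M, (of fun j k => L (σ (m.succ.castSucc, j)) (m.succ.castSucc, k)) =
      -of fun j k => D (m.succ, j) (m.castSucc, k) := by
    intro m
    ext j k
    change L (σ (m.succ.castSucc, j)) (m.castSucc.succ, k) = -D (m.succ, j) (m.castSucc, k)
    rw [hcast]
    simp [hL]
  have b2 : (of fun j k => L (σ (Fin.last (M + 1), j)) (Fin.last (M + 1), k)) =
      -of fun j k => B j (Fin.last M, k) := by
    ext j k
    change L (σ (Fin.last (M + 1), j)) ((Fin.last M).succ, k) = -B j (Fin.last M, k)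
    rw [hlast, hL, submatrix_apply, consBlock_zero, consBlock_succ]
    simp
  simp only [b0, b1, b2, det_neg, Finset.prod_mul_distrib, Fintype.card_fin, Finset.prod_const,
    Finset.card_univ] at hprod
  have hsq : ((((-1 : R)) ^ N) ^ (M + 1)) * (((-1 : R)) ^ N) ^ (M + 1) = 1 := by
    rw [← mul_pow, ← mul_pow]; simp
  calc (fromBlocks 1 (-B) F (-D)).det
      = (((-1 : R) ^ N) ^ (M + 1)) * ((((-1 : R) ^ N) ^ (M + 1)) *
          (fromBlocks 1 (-B) F (-D)).det) := by rw [← mul_assoc, hsq, one_mul]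
    _ = ((((-1 : R)) ^ N) ^ (M + 1)) * (((-1 : R)) ^ N) ^ (M + 1) *
          ((of fun j k => F (0, j) k).det *
        (∏ m : Fin M, (of fun j k => D (m.succ, j) (m.castSucc, k)).det) *
        (of fun j k => B j (Fin.last M, k)).det) := by rw [hprod]; ring
    _ = _ := by rw [hsq, one_mul]

end

lemma det_heatPoly {N : ℕ} (t : ℝ) (x : Fin N → ℝ) :
    (Matrix.of fun j k : Fin N => (heatPoly t j).eval (x k)).det = vandermonde x := by
  rw [← Matrix.det_transpose, vandermonde, ← Matrix.det_vandermonde,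
    Matrix.det_eval_matrixOfPolynomials_eq_det_vandermonde x (fun j => heatPoly t j)
      (fun j => natDegree_heatPoly t j) (fun j => monic_heatPoly t j)]
  rfl

lemma gueConst_eq (N : ℕ) : gueConst N =
    (2 * Real.pi) ^ ((N : ℝ) / 2) * ∏ k ∈ Finset.range N, (k.factorial : ℝ) := by
  unfold gueConst
  congr 1
  induction N with
  | zero => simp
  | succ N ih =>
    rw [Finset.prod_Icc_succ_top (by omega), Finset.prod_range_succ, ih]
    push_cast
    rw [Real.Gamma_nat_eq_factorial]

lemma prod_pow_eq_rpow {t : ℝ} (ht : 0 < t) (N : ℕ) :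
    ∏ k ∈ Finset.range N, t ^ k = t ^ (((N : ℝ) ^ 2 - N) / 2) := by
  induction N with
  | zero => simp
  | succ N ih =>
    rw [Finset.prod_range_succ, ih, ← Real.rpow_natCast t N, ← Real.rpow_add ht]
    congr 1
    push_cast
    ring

lemma det_heatDual {N : ℕ} {t : ℝ} (ht : 0 < t) (x : Fin N → ℝ) :
    (Matrix.of fun j k : Fin N => heatDual t k (x j)).det =
      1 / gueConst N * t ^ (-((N : ℝ) ^ 2 / 2)) * Real.exp (-(∑ j, x j ^ 2) / (2 * t)) *
        vandermonde x := by
  have h1 : (Matrix.of fun j k : Fin N => heatDual t k (x j)) =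
      Matrix.of fun j k : Fin N => heatKernel t (x j) 0 *
        (Matrix.of fun j k : Fin N => (1 / ((k : ℕ).factorial * t ^ (k : ℕ)) : ℝ) *
          (Matrix.of fun j k : Fin N => (heatPoly t k).eval (x j)) j k) j k := by
    ext j k
    simp only [heatDual, Matrix.of_apply]
    ring
  have h2 : (Matrix.of fun j k : Fin N => (heatPoly t k).eval (x j)).det = vandermonde x := by
    rw [← det_heatPoly t x, ← Matrix.det_transpose]
    rfl
  rw [h1, Matrix.det_mul_column, Matrix.det_mul_row, h2, ← mul_assoc]
  congr 1
  have h3 : ∏ j, heatKernel t (x j) 0 = 1 / ((2 * Real.pi) ^ ((N : ℝ) / 2) * t ^ ((N : ℝ) / 2)) *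
      Real.exp (-(∑ j, x j ^ 2) / (2 * t)) := by
    simp only [heatKernel, Finset.prod_mul_distrib, ← Real.exp_sum, Finset.prod_const,
      Finset.card_univ, Fintype.card_fin, sub_zero]
    rw [← Real.mul_rpow (by positivity) ht.le, Real.sqrt_eq_rpow, div_pow, one_pow,
      ← Real.rpow_mul_natCast (by positivity), ← Finset.sum_div, Finset.sum_neg_distrib]
    congr 3
    ring
  have h4 : ∏ k : Fin N, (1 / ((k : ℕ).factorial * t ^ (k : ℕ)) : ℝ) =
      1 / ((∏ k ∈ Finset.range N, (k.factorial : ℝ)) * t ^ (((N : ℝ) ^ 2 - N) / 2)) := by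
    rw [← prod_pow_eq_rpow ht, ← Finset.prod_mul_distrib,
      Finset.prod_range (fun k => (k.factorial : ℝ) * t ^ k), Finset.prod_div_distrib]
    simp
  have h5 : t ^ (-((N : ℝ) ^ 2 / 2)) =
      1 / (t ^ ((N : ℝ) / 2) * t ^ (((N : ℝ) ^ 2 - N) / 2)) := by
    rw [← Real.rpow_add ht, Real.rpow_neg ht.le, one_div]
    congr 2
    ring
  rw [h3, h4, h5, gueConst_eq]
  ring

lemma karlinMcGregor_eq_zero {N : ℕ} (t : ℝ) (y : Fin N → ℝ) {x : Fin N → ℝ}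
    (hx : vandermonde x = 0) : karlinMcGregor t y x = 0 := by
  obtain ⟨j, -, hj⟩ := Finset.prod_eq_zero_iff.1 hx
  obtain ⟨k, hk, hjk⟩ := Finset.prod_eq_zero_iff.1 hj
  refine Matrix.det_zero_of_column_eq (ne_of_lt (Finset.mem_Ioi.1 hk)) fun i => ?_
  simp [sub_eq_zero.1 hjk]

/-- The factors `h_N` telescope; at a configuration with coinciding coordinates both sides
vanish. -/
lemma multitimeDensity_eq {M N : ℕ} (t : Fin (M + 1) → ℝ) (x : Fin (M + 1) → Fin N → ℝ) :
    multitimeDensity t x = 1 / gueConst N * t 0 ^ (-((N : ℝ) ^ 2 / 2)) *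
      Real.exp (-(∑ j, x 0 j ^ 2) / (2 * t 0)) * vandermonde (x 0) *
      (∏ m : Fin M, karlinMcGregor (t m.succ - t m.castSucc) (x m.succ) (x m.castSucc)) *
      vandermonde (x (Fin.last M)) := by
  have key : (∏ m : Fin M, transitionDensity (t m.succ - t m.castSucc) (x m.succ)
        (x m.castSucc)) * vandermonde (x 0) =
      (∏ m : Fin M, karlinMcGregor (t m.succ - t m.castSucc) (x m.succ) (x m.castSucc)) *
        vandermonde (x (Fin.last M)) := by
    by_cases h : ∃ m : Fin M, vandermonde (x m.castSucc) = 0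
    · obtain ⟨m, hm⟩ := h
      have hk := karlinMcGregor_eq_zero (t m.succ - t m.castSucc) (x m.succ) hm
      rw [Finset.prod_eq_zero (Finset.mem_univ m) (by rw [transitionDensity, hk, mul_zero]),
        Finset.prod_eq_zero (Finset.mem_univ m) hk]
      simp
    · push Not at h
      have h1 : ∏ m : Fin M, vandermonde (x m.castSucc) ≠ 0 :=
        Finset.prod_ne_zero_iff.2 fun m _ => h m
      have h2 : (∏ m : Fin M, vandermonde (x m.castSucc)) * vandermonde (x (Fin.last M)) =
          vandermonde (x 0) * ∏ m : Fin M, vandermonde (x m.succ) := by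
        rw [← Fin.prod_univ_castSucc (fun m => vandermonde (x m)),
          Fin.prod_univ_succ (fun m => vandermonde (x m))]
      simp only [transitionDensity, Finset.prod_mul_distrib, Finset.prod_div_distrib]
      field_simp
      linear_combination (-(∏ m : Fin M,
        karlinMcGregor (t m.succ - t m.castSucc) (x m.succ) (x m.castSucc))) * h2
  unfold multitimeDensity gueDensity
  linear_combination (1 / gueConst N * t 0 ^ (-((N : ℝ) ^ 2 / 2)) *
      Real.exp (-(∑ j, x 0 j ^ 2) / (2 * t 0)) * vandermonde (x 0)) * key

/-- With all `N` particles present at each time the determinant is the multitime density. -/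
theorem det_corrMatrix_eq_multitimeDensity {M N : ℕ} {t : Fin (M + 1) → ℝ} (ht0 : 0 < t 0)
    (ht : StrictMono t) (x : Fin (M + 1) → Fin N → ℝ) :
    (corrMatrix N (fun p : Fin (M + 1) × Fin N => t p.1) (fun p => x p.1 p.2)).det =
      multitimeDensity t x := by
  set F : Matrix (Fin (M + 1) × Fin N) (Fin N) ℝ :=
    Matrix.of fun p k => heatDual (t p.1) k (x p.1 p.2) with hF
  set B : Matrix (Fin N) (Fin (M + 1) × Fin N) ℝ :=
    Matrix.of fun k q => (heatPoly (t q.1) k).eval (x q.1 q.2) with hB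
  set D : Matrix (Fin (M + 1) × Fin N) (Fin (M + 1) × Fin N) ℝ :=
    Matrix.of fun p q => if t q.1 < t p.1 then
      heatKernel (t p.1 - t q.1) (x p.1 p.2) (x q.1 q.2) else 0 with hD
  have h1 : corrMatrix N (fun p : Fin (M + 1) × Fin N => t p.1) (fun p => x p.1 p.2) =
      -D - F * (-B) := by
    ext p q
    simp only [corrMatrix, corrKernel, heatProj, hF, hB, hD, Matrix.of_apply, Matrix.sub_apply,
      Matrix.neg_apply, Matrix.mul_neg, Matrix.mul_apply, Finset.sum_range]
    ring
  rw [h1, ← Matrix.det_fromBlocks_one₁₁, det_fromBlocks_cyclic B F D, multitimeDensity_eq]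
  · congr 2
    · exact det_heatDual ht0 (x 0)
    · refine Finset.prod_congr rfl fun m _ => ?_
      unfold karlinMcGregor
      congr 1
      ext j k
      simp [hD, ht (Fin.castSucc_lt_succ (i := m))]
    · exact det_heatPoly (t (Fin.last M)) (x (Fin.last M))
  · intro p q hpq
    simp [hD, (ht.monotone hpq).not_gt]

/-! ### A Gaussian bound for the multitime density -/

lemma heatKernel_nonneg (t x y : ℝ) : 0 ≤ heatKernel t x y := by
  unfold heatKernel; positivity

/-- Some of the Gaussian decay at the starting point is traded for decay at the end point. -/
lemma heatKernel_le {τ c : ℝ} (hτ : 0 < τ) (hc : 0 ≤ c) (hcτ : c ≤ 1 / (2 * τ)) (y x : ℝ) :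
    heatKernel τ y x ≤ 1 / Real.sqrt (2 * Real.pi * τ) *
      (Real.exp (c * x ^ 2) * Real.exp (-(c / 2) * y ^ 2)) := by
  unfold heatKernel
  rw [← Real.exp_add]
  refine mul_le_mul_of_nonneg_left (Real.exp_le_exp.2 ?_) (by positivity)
  have h1 : c * (y - x) ^ 2 ≤ 1 / (2 * τ) * (y - x) ^ 2 :=
    mul_le_mul_of_nonneg_right hcτ (sq_nonneg _)
  have h2 : -(y - x) ^ 2 / (2 * τ) = -(1 / (2 * τ) * (y - x) ^ 2) := by ring
  rw [h2]
  nlinarith [mul_nonneg hc (sq_nonneg (y - 2 * x))]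

lemma abs_karlinMcGregor_le {N : ℕ} {τ c : ℝ} (hτ : 0 < τ) (hc : 0 ≤ c) (hcτ : c ≤ 1 / (2 * τ))
    (y x : Fin N → ℝ) :
    |karlinMcGregor τ y x| ≤ (N.factorial * (1 / Real.sqrt (2 * Real.pi * τ)) ^ N) *
      Real.exp (c * ∑ j, x j ^ 2 - c / 2 * ∑ j, y j ^ 2) := by
  unfold karlinMcGregor
  rw [Matrix.det_apply']
  refine (Finset.abs_sum_le_sum_abs _ _).trans ?_
  have h : ∀ σ ∈ (Finset.univ : Finset (Equiv.Perm (Fin N))),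
      |((Equiv.Perm.sign σ : ℤ) : ℝ) * ∏ j, Matrix.of (fun j k => heatKernel τ (y j) (x k)) (σ j) j|
        ≤ (1 / Real.sqrt (2 * Real.pi * τ)) ^ N *
          Real.exp (c * ∑ j, x j ^ 2 - c / 2 * ∑ j, y j ^ 2) := by
    intro σ _
    have hs : |((Equiv.Perm.sign σ : ℤ) : ℝ)| = 1 := by
      rcases Int.units_eq_one_or (Equiv.Perm.sign σ) with h | h <;> simp [h]
    rw [abs_mul, hs, one_mul, Finset.abs_prod]
    calc ∏ j, |Matrix.of (fun j k => heatKernel τ (y j) (x k)) (σ j) j|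
        ≤ ∏ j, (1 / Real.sqrt (2 * Real.pi * τ) *
          (Real.exp (c * x j ^ 2) * Real.exp (-(c / 2) * y (σ j) ^ 2))) :=
          Finset.prod_le_prod (fun _ _ => abs_nonneg _) fun j _ => by
            rw [Matrix.of_apply, abs_of_nonneg (heatKernel_nonneg _ _ _)]
            exact heatKernel_le hτ hc hcτ _ _
      _ = _ := by
          rw [Finset.prod_mul_distrib, Finset.prod_mul_distrib, ← Real.exp_sum, ← Real.exp_sum,
            ← Real.exp_add, ← Finset.mul_sum, ← Finset.mul_sum,
            Equiv.sum_comp σ (fun j => y j ^ 2), Finset.prod_const, Finset.card_univ,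
            Fintype.card_fin]
          congr 2
          ring
  refine (Finset.sum_le_card_nsmul _ _ _ h).trans (le_of_eq ?_)
  rw [Finset.card_univ, Fintype.card_perm, Fintype.card_fin, nsmul_eq_mul]
  ring

/-- Absorbing Brownian motion started from a Gaussian weight has Gaussian decay in all positions
at all times. -/
lemma exists_bound_prod_karlinMcGregor (N : ℕ) {a : ℝ} (ha : 0 < a) {M : ℕ} (τ : Fin M → ℝ)
    (hτ : ∀ m, 0 < τ m) :
    ∃ C δ : ℝ, 0 ≤ C ∧ 0 < δ ∧ ∀ x : Fin (M + 1) → Fin N → ℝ,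
      Real.exp (-a * ∑ j, x 0 j ^ 2) *
        ∏ m : Fin M, |karlinMcGregor (τ m) (x m.succ) (x m.castSucc)| ≤
          C * Real.exp (-δ * ∑ m, ∑ j, x m j ^ 2) := by
  induction M with
  | zero => exact ⟨1, a, zero_le_one, ha, fun x => by simp⟩
  | succ M ih =>
    obtain ⟨C, δ, hC, hδ, h⟩ := ih (fun m => τ m.castSucc) (fun m => hτ _)
    have hτM := hτ (Fin.last M)
    -- `c ≤ δ / 2` leaves half of the decay at the last but one time
    set c := min (δ / 2) (1 / (2 * τ (Fin.last M))) with hc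
    have hc0 : 0 < c := lt_min (by positivity) (by positivity)
    have hcδ : c ≤ δ / 2 := min_le_left _ _
    refine ⟨C * (N.factorial * (1 / Real.sqrt (2 * Real.pi * τ (Fin.last M))) ^ N), c / 2,
      by positivity, by positivity, fun x => ?_⟩
    have h1 := h (fun m => x m.castSucc)
    have h2 := abs_karlinMcGregor_le hτM hc0.le (min_le_right _ _) (x (Fin.last (M + 1)))
      (x (Fin.last M).castSucc)
    rw [Fin.prod_univ_castSucc, ← mul_assoc]
    refine (mul_le_mul h1 h2 (abs_nonneg _) (by positivity)).trans ?_
    rw [Fin.sum_univ_castSucc (n := M + 1)]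
    set S := ∑ m : Fin (M + 1), ∑ j, x m.castSucc j ^ 2 with hS
    have h3 : ∑ j, x (Fin.last M).castSucc j ^ 2 ≤ S :=
      Finset.single_le_sum (f := fun m : Fin (M + 1) => ∑ j, x m.castSucc j ^ 2)
        (fun m _ => Finset.sum_nonneg fun j _ => sq_nonneg _) (Finset.mem_univ _)
    have hS0 : 0 ≤ S := Finset.sum_nonneg fun m _ => Finset.sum_nonneg fun j _ => sq_nonneg _
    rw [mul_mul_mul_comm, ← Real.exp_add]
    refine mul_le_mul_of_nonneg_left (Real.exp_le_exp.2 ?_) (by positivity)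
    nlinarith [mul_le_mul_of_nonneg_left h3 hc0.le, mul_le_mul_of_nonneg_right hcδ hS0]

lemma exists_bound_vandermonde (N : ℕ) {ε : ℝ} (hε : 0 < ε) :
    ∃ C : ℝ, 0 ≤ C ∧ ∀ x : Fin N → ℝ, |vandermonde x| ≤ C * Real.exp (ε * ∑ j, x j ^ 2) := by
  -- there are at most `N * N` factors, each bounded by a multiple of `exp (η * ∑ x_j ^ 2)`
  set η := ε / (N * N + 1) with hη
  have hη0 : 0 < η := by positivity
  refine ⟨(1 + 2 / η) ^ (N * N), by positivity, fun x => ?_⟩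
  set S := ∑ j, x j ^ 2 with hS
  have hS0 : 0 ≤ S := Finset.sum_nonneg fun j _ => sq_nonneg _
  set D := (1 + 2 / η) * Real.exp (η * S) with hD
  have hD1 : 1 ≤ D := by
    have h1 : 1 ≤ 1 + 2 / η := by have := div_pos two_pos hη0; linarith
    have h2 : 1 ≤ Real.exp (η * S) := Real.one_le_exp (by positivity)
    nlinarith
  have hpair : ∀ j k, |x k - x j| ≤ D := by
    intro j k
    have hj : x j ^ 2 ≤ S := Finset.single_le_sum (fun i _ => sq_nonneg (x i)) (Finset.mem_univ j)
    have hk : x k ^ 2 ≤ S := Finset.single_le_sum (fun i _ => sq_nonneg (x i)) (Finset.mem_univ k)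
    have h1 : |x k - x j| ≤ 1 + 2 * S := by
      rw [abs_le]
      constructor <;> nlinarith [sq_nonneg (x k - 1), sq_nonneg (x k + 1), sq_nonneg (x j - 1),
        sq_nonneg (x j + 1)]
    have h2 : 1 + 2 * S ≤ (1 + 2 / η) * (1 + η * S) := by
      have : (1 + 2 / η) * (1 + η * S) = 1 + 2 * S + (2 / η + η * S) := by field_simp; ring
      rw [this]
      have : 0 ≤ 2 / η + η * S := by positivity
      linarith
    refine h1.trans (h2.trans (mul_le_mul_of_nonneg_left ?_ (by positivity)))
    linarith [Real.add_one_le_exp (η * S)]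
  have hprod : |vandermonde x| ≤ D ^ (N * N) := by
    unfold vandermonde
    rw [Finset.abs_prod]
    calc ∏ j : Fin N, |∏ k ∈ Finset.Ioi j, (x k - x j)| ≤ ∏ _j : Fin N, D ^ N := by
          refine Finset.prod_le_prod (fun _ _ => abs_nonneg _) fun j _ => ?_
          rw [Finset.abs_prod]
          refine (Finset.prod_le_prod (fun _ _ => abs_nonneg _) fun k _ => hpair j k).trans ?_
          rw [Finset.prod_const]
          exact pow_le_pow_right₀ hD1 ((Finset.card_le_univ _).trans (by simp))
      _ = D ^ (N * N) := by simp [pow_mul]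
  refine hprod.trans ?_
  rw [hD, mul_pow, ← Real.exp_nat_mul]
  refine mul_le_mul_of_nonneg_left (Real.exp_le_exp.2 ?_) (by positivity)
  rw [← mul_assoc]
  refine mul_le_mul_of_nonneg_right ?_ hS0
  rw [hη, mul_div_assoc', div_le_iff₀ (by positivity)]
  push_cast
  nlinarith

theorem exists_bound_multitimeDensity {M N : ℕ} {t : Fin (M + 1) → ℝ} (ht0 : 0 < t 0)
    (ht : StrictMono t) :
    ∃ C δ : ℝ, 0 < δ ∧ ∀ x : Fin (M + 1) → Fin N → ℝ,
      |multitimeDensity t x| ≤ C * ∏ p : Fin (M + 1) × Fin N, Real.exp (-δ * x p.1 p.2 ^ 2) := by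
  obtain ⟨C, δ, hC, hδ, h⟩ := exists_bound_prod_karlinMcGregor N (a := 1 / (2 * t 0))
    (by positivity) (fun m : Fin M => t m.succ - t m.castSucc)
    (fun m => sub_pos.2 (ht Fin.castSucc_lt_succ))
  -- the two Vandermonde factors use up half of the Gaussian decay
  obtain ⟨V, hV, hv⟩ := exists_bound_vandermonde N (ε := δ / 4) (by positivity)
  refine ⟨|1 / gueConst N * t 0 ^ (-((N : ℝ) ^ 2 / 2))| * (C * (V * V)), δ / 2, by positivity,
    fun x => ?_⟩
  have hp : ∏ p : Fin (M + 1) × Fin N, Real.exp (-(δ / 2) * x p.1 p.2 ^ 2) =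
      Real.exp (-(δ / 2) * ∑ m, ∑ j, x m j ^ 2) := by
    rw [← Real.exp_sum, ← Finset.mul_sum, Fintype.sum_prod_type]
  have hle : ∀ m, ∑ j, x m j ^ 2 ≤ ∑ m, ∑ j, x m j ^ 2 := fun m =>
    Finset.single_le_sum (f := fun m : Fin (M + 1) => ∑ j, x m j ^ 2)
      (fun m _ => Finset.sum_nonneg fun j _ => sq_nonneg _) (Finset.mem_univ m)
  rw [hp, multitimeDensity_eq]
  have e : -(∑ j, x 0 j ^ 2) / (2 * t 0) = -(1 / (2 * t 0)) * ∑ j, x 0 j ^ 2 := by ring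
  rw [e]
  calc _ = |1 / gueConst N * t 0 ^ (-((N : ℝ) ^ 2 / 2))| *
        ((Real.exp (-(1 / (2 * t 0)) * ∑ j, x 0 j ^ 2) *
          ∏ m : Fin M, |karlinMcGregor (t m.succ - t m.castSucc) (x m.succ) (x m.castSucc)|) *
        (|vandermonde (x 0)| * |vandermonde (x (Fin.last M))|)) := by
          rw [abs_mul, abs_mul, abs_mul, abs_mul, Real.abs_exp, Finset.abs_prod]
          ring
    _ ≤ |1 / gueConst N * t 0 ^ (-((N : ℝ) ^ 2 / 2))| *
        ((C * Real.exp (-δ * ∑ m, ∑ j, x m j ^ 2)) *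
        ((V * Real.exp (δ / 4 * ∑ m, ∑ j, x m j ^ 2)) *
          (V * Real.exp (δ / 4 * ∑ m, ∑ j, x m j ^ 2)))) := by
          have hv' : ∀ m, |vandermonde (x m)| ≤ V * Real.exp (δ / 4 * ∑ m, ∑ j, x m j ^ 2) :=
            fun m => (hv (x m)).trans (mul_le_mul_of_nonneg_left (Real.exp_le_exp.2
              (mul_le_mul_of_nonneg_left (hle m) (by positivity))) hV)
          refine mul_le_mul_of_nonneg_left (mul_le_mul (h x) (mul_le_mul (hv' _) (hv' _)
            (abs_nonneg _) (by positivity)) (by positivity) (by positivity)) (abs_nonneg _)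
    _ = _ := by
          have : Real.exp (-(δ / 2) * ∑ m, ∑ j, x m j ^ 2) =
              Real.exp (-δ * ∑ m, ∑ j, x m j ^ 2) * (Real.exp (δ / 4 * ∑ m, ∑ j, x m j ^ 2) *
                Real.exp (δ / 4 * ∑ m, ∑ j, x m j ^ 2)) := by
            rw [← Real.exp_add, ← Real.exp_add]
            congr 1
            ring
          rw [this]
          ring

/-! ### Integrating out several particles -/

lemma continuous_corrKernel (N : ℕ) (t s : ℝ) :
    Continuous fun p : ℝ × ℝ => corrKernel N t p.1 s p.2 := by
  have h1 : ∀ k, Continuous fun y => (heatPoly t k).eval y := fun k => (heatPoly t k).continuous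
  have h2 : ∀ k, Continuous fun y => (heatPoly s k).eval y := fun k => (heatPoly s k).continuous
  unfold corrKernel heatProj heatDual heatKernel
  refine Continuous.sub (continuous_finsetSum _ fun k _ => ?_) ?_
  · exact Continuous.mul (Continuous.div_const (Continuous.mul ((h1 k).comp continuous_fst)
      (by fun_prop)) _) ((h2 k).comp continuous_snd)
  · split_ifs
    · fun_prop
    · fun_prop

lemma continuous_det_corrMatrix {α : Type*} [Fintype α] [DecidableEq α] (N : ℕ) (T : α → ℝ) :
    Continuous fun x : α → ℝ => (corrMatrix N T x).det := by
  refine Continuous.matrix_det (continuous_matrix fun a b => ?_)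
  exact (continuous_corrKernel N (T a) (T b)).comp
    (Continuous.prodMk (continuous_apply a) (continuous_apply b) :
      Continuous fun x : α → ℝ => (x a, x b))

lemma det_corrMatrix_comp {α β : Type*} [Fintype α] [DecidableEq α] [Fintype β] [DecidableEq β]
    (N : ℕ) (e : β ≃ α) (T x : α → ℝ) :
    (corrMatrix N (T ∘ e) (x ∘ e)).det = (corrMatrix N T x).det :=
  Matrix.det_submatrix_equiv_self e (corrMatrix N T x)

/-- Moving the first of `k + 1` further indices to the left summand. -/
def sumFinSucc (α : Type*) (k : ℕ) : (α ⊕ Unit) ⊕ Fin k ≃ α ⊕ Fin (k + 1) where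
  toFun := Sum.elim (Sum.elim Sum.inl fun _ => Sum.inr 0) fun i => Sum.inr i.succ
  invFun := Sum.elim (fun a => Sum.inl (Sum.inl a))
    (fun i => Fin.cases (Sum.inl (Sum.inr ())) (fun i => Sum.inr i) i)
  left_inv p := by rcases p with (p | p) | p <;> rfl
  right_inv p := by
    rcases p with p | p
    · rfl
    · induction p using Fin.cases <;> rfl

lemma elim_comp_sumFinSucc {α : Type*} {k : ℕ} {β : Type*} (f : α → β) (r : β) (g : Fin k → β) :
    Sum.elim f (Fin.cons r g : Fin (k + 1) → β) ∘ sumFinSucc α k =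
      Sum.elim (Sum.elim f fun _ => r) g := by
  funext p
  rcases p with (p | p) | p <;> simp [sumFinSucc]

lemma integrable_of_abs_le_prod {k : ℕ} {f : (Fin k → ℝ) → ℝ} (hf : Continuous f) {g : ℝ → ℝ}
    (hg : Integrable g) {C : ℝ} (h : ∀ y, |f y| ≤ C * ∏ i, g (y i)) : Integrable f :=
  ((Integrable.fintype_prod (fun _ => hg)).const_mul C).mono' hf.aestronglyMeasurable
    (Filter.Eventually.of_forall h)

/-- Integrating out all particles that are needed to complete the system to `N` particles at each
time. The hypothesis with `g` is a product bound, uniform in all positions, which justifies the use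
of Fubini's theorem. -/
theorem integral_det_corrMatrix {M N : ℕ} {t : Fin (M + 1) → ℝ} (hpos : ∀ m, 0 < t m)
    (ht : Function.Injective t) {g : ℝ → ℝ} (hg : Integrable g) {C : ℝ} {k : ℕ} :
    ∀ {α : Type} [Fintype α] [DecidableEq α] (τ : α → Fin (M + 1)) (x : α → ℝ)
      (τ' : Fin k → Fin (M + 1))
      (_ : ∀ w : α ⊕ Fin k → ℝ,
        |(corrMatrix N (t ∘ Sum.elim τ τ') w).det| ≤ C * ∏ p, g (w p))
      (_ : ∀ m, (Finset.univ.filter fun a => τ a = m).card +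
        (Finset.univ.filter fun i => τ' i = m).card = N),
      ∫ y : Fin k → ℝ, (corrMatrix N (t ∘ Sum.elim τ τ') (Sum.elim x y)).det =
        (∏ m, ((Finset.univ.filter fun i => τ' i = m).card.factorial : ℝ)) *
          (corrMatrix N (t ∘ τ) x).det := by
  induction k with
  | zero =>
    intro α _ _ τ x τ' hb hc
    have h : ∀ y : Fin 0 → ℝ, (corrMatrix N (t ∘ Sum.elim τ τ') (Sum.elim x y)).det =
        (corrMatrix N (t ∘ τ) x).det := by
      intro y
      rw [← det_corrMatrix_comp N (Equiv.sumEmpty α (Fin 0)) (t ∘ τ) x]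
      congr 2 <;> funext p <;> rcases p with p | p <;> first | rfl | exact p.elim0
    simp [h, measureReal_def, volume_pi]
  | succ k ih =>
    intro α _ _ τ x τ' hb hc
    set r := τ' 0 with hr
    set τ'' : Fin k → Fin (M + 1) := fun i => τ' i.succ with hτ''
    have hcons : τ' = Fin.cons r τ'' := (Fin.cons_self_tail τ').symm
    have hcard : ∀ m, (Finset.univ.filter fun i => τ' i = m).card =
        (Finset.univ.filter fun i => τ'' i = m).card + if r = m then 1 else 0 := by
      intro m
      rw [Finset.card_filter, Finset.card_filter, Fin.sum_univ_succ, add_comm]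
    have hcard' : ∀ m, (Finset.univ.filter fun a => (Sum.elim τ fun _ : Unit => r) a = m).card =
        (Finset.univ.filter fun a => τ a = m).card + if r = m then 1 else 0 := by
      intro m
      rw [Finset.card_filter, Finset.card_filter, Fintype.sum_sum_type]
      simp only [Sum.elim_inl, Sum.elim_inr, Finset.univ_unique, Finset.sum_singleton]
      congr!
    have hdet : ∀ (v : α → ℝ) (z : ℝ) (y : Fin k → ℝ),
        (corrMatrix N (t ∘ Sum.elim τ τ') (Sum.elim v (Fin.cons z y : Fin (k + 1) → ℝ))).det =
        (corrMatrix N (t ∘ Sum.elim (Sum.elim τ fun _ : Unit => r) τ'')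
          (Sum.elim (Sum.elim v fun _ => z) y)).det := by
      intro v z y
      rw [← det_corrMatrix_comp N (sumFinSucc α k), elim_comp_sumFinSucc, Function.comp_assoc,
        hcons, elim_comp_sumFinSucc]
    have hint : Integrable fun y : Fin (k + 1) → ℝ =>
        (corrMatrix N (t ∘ Sum.elim τ τ') (Sum.elim x y)).det := by
      refine integrable_of_abs_le_prod (C := C * ∏ a, g (x a))
        ((continuous_det_corrMatrix N _).comp ?_) hg fun y => ?_
      · refine continuous_pi fun p => ?_
        rcases p with p | p
        · exact continuous_const
        · exact continuous_apply p
      · have := hb (Sum.elim x y)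
        simpa [Fintype.prod_sum_type, mul_assoc] using this
    have hIH : ∀ z, ∫ y : Fin k → ℝ, (corrMatrix N
        (t ∘ Sum.elim (Sum.elim τ fun _ : Unit => r) τ'') (Sum.elim (Sum.elim x fun _ => z) y)).det =
        (∏ m, ((Finset.univ.filter fun i => τ'' i = m).card.factorial : ℝ)) *
          (corrMatrix N (Sum.elim (t ∘ τ) fun _ : Unit => t r) (Sum.elim x fun _ => z)).det := by
      intro z
      rw [ih (Sum.elim τ fun _ : Unit => r) (Sum.elim x fun _ => z) τ'']
      · rw [Sum.comp_elim]; rfl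
      · intro w
        obtain ⟨v, u, y, rfl⟩ : ∃ (v : α → ℝ) (u : ℝ) (y : Fin k → ℝ),
            w = Sum.elim (Sum.elim v fun _ => u) y :=
          ⟨fun a => w (Sum.inl (Sum.inl a)), w (Sum.inl (Sum.inr ())), fun i => w (Sum.inr i), by
            funext p; rcases p with (p | p) | p <;> rfl⟩
        rw [← hdet]
        refine (hb _).trans (le_of_eq ?_)
        simp [Fintype.prod_sum_type, Fin.prod_univ_succ, mul_assoc]
      · intro m
        have := hc m
        have := hcard m
        have := hcard' m
        omega
    -- integrate over the last `k` variables by induction, then over the first one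
    have hmp := (volume_preserving_piFinSuccAbove (fun _ : Fin (k + 1) => ℝ) 0).symm
    rw [← hmp.integral_comp' (g := fun y : Fin (k + 1) → ℝ =>
      (corrMatrix N (t ∘ Sum.elim τ τ') (Sum.elim x y)).det)]
    have hint' := (hmp.integrable_comp_emb (MeasurableEquiv.measurableEmbedding _)).2 hint
    have hsymm : ∀ p : ℝ × (Fin k → ℝ),
        (MeasurableEquiv.piFinSuccAbove (fun _ : Fin (k + 1) => ℝ) 0).symm p =
          (Fin.cons p.1 p.2 : Fin (k + 1) → ℝ) := by
      intro p
      simp [MeasurableEquiv.piFinSuccAbove]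
      rfl
    simp only [Function.comp_def, hsymm] at hint' ⊢
    rw [Measure.volume_eq_prod, integral_prod _ hint']
    have hdet' := hdet x
    simp only [Function.comp_def] at hdet' hIH
    simp only [hdet', hIH]
    rw [integral_const_mul, (integratesTo_det_corrMatrix N (fun a => t (τ a)) x (hpos r)).2,
      ← mul_assoc]
    congr 1
    have hN : (N : ℝ) - ((Finset.univ.filter fun a => t (τ a) = t r).card : ℝ) =
        (Finset.univ.filter fun i => τ'' i = r).card + 1 := by
      have h1 := hc r
      have h2 := hcard r
      simp only [ht.eq_iff, if_true] at h2 ⊢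
      have h3 : (N : ℝ) = (Finset.univ.filter fun a => τ a = r).card +
        ((Finset.univ.filter fun i => τ'' i = r).card + 1 : ℕ) := by
          rw [← h2, ← h1]; push_cast; ring
      rw [h3]
      push_cast
      ring
    have hfac : ∀ m, ((Finset.univ.filter fun i => τ' i = m).card.factorial : ℝ) =
        (Finset.univ.filter fun i => τ'' i = m).card.factorial *
          if r = m then ((Finset.univ.filter fun i => τ'' i = m).card + 1 : ℝ) else 1 := by
      intro m
      rw [hcard m]
      split_ifs
      · rw [Nat.factorial_succ]; push_cast; ring
      · simp
    simp only [hfac, Finset.prod_mul_distrib, Finset.prod_ite_eq, Finset.mem_univ, if_true]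
    rw [hN]

/-! ### Fourier representation of the dual functions -/

/-- The Fourier integrand of `(-∂_y)^k p(t, y | 0)`, without the factor `1 / (2π)`. -/
noncomputable def wave (t y : ℝ) (k : ℕ) (u : ℝ) : ℂ :=
  (Complex.I * u) ^ k * (Complex.exp (Complex.I * (-y : ℂ) * u) *
    Complex.exp (-(t / 2 : ℂ) * (u : ℂ) ^ 2))

lemma norm_wave (t y : ℝ) (k : ℕ) (u : ℝ) :
    ‖wave t y k u‖ = |u| ^ k * Real.exp (-(t / 2) * u ^ 2) := by
  unfold wave
  rw [norm_mul, norm_mul, norm_pow, Complex.norm_exp, Complex.norm_exp]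
  simp [← Complex.ofReal_pow]

lemma continuous_wave (t y : ℝ) (k : ℕ) : Continuous (wave t y k) := by
  unfold wave
  fun_prop

lemma integrable_wave {t : ℝ} (ht : 0 < t) (y : ℝ) (k : ℕ) : Integrable (wave t y k) := by
  have h := integrable_rpow_mul_exp_neg_mul_sq (b := t / 2) (by positivity) (s := k)
    (by have : (0 : ℝ) ≤ k := Nat.cast_nonneg k
        linarith)
  refine h.norm.mono' (continuous_wave t y k).aestronglyMeasurable
    (Filter.Eventually.of_forall fun u => ?_)
  rw [norm_wave, norm_mul, Real.norm_eq_abs, Real.norm_eq_abs, Real.abs_exp, Real.rpow_natCast,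
    abs_pow]

lemma hasDerivAt_wave_zero (t y u : ℝ) :
    HasDerivAt (wave t y 0) (Complex.I * (t * wave t y 1 u - y * wave t y 0 u)) u := by
  unfold wave
  have h0 : HasDerivAt (fun u : ℝ => (u : ℂ)) 1 u := Complex.ofRealCLM.hasDerivAt
  have h2 : HasDerivAt (fun u : ℝ => Complex.exp (Complex.I * (-y : ℂ) * u))
      (Complex.exp (Complex.I * (-y : ℂ) * u) * (Complex.I * (-y : ℂ))) u :=
    (h0.const_mul (Complex.I * (-y : ℂ))).cexp.congr_deriv (by ring)
  have h3 : HasDerivAt (fun u : ℝ => Complex.exp (-(t / 2 : ℂ) * (u : ℂ) ^ 2))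
      (Complex.exp (-(t / 2 : ℂ) * (u : ℂ) ^ 2) * (-t * u)) u := by
    refine ((h0.pow 2).const_mul (-(t / 2 : ℂ))).cexp.congr_deriv ?_
    simp
    ring
  simp only [pow_zero, one_mul]
  refine (h2.mul h3).congr_deriv ?_
  have hI : Complex.I ^ 2 = -1 := Complex.I_sq
  linear_combination (-(t : ℂ) * u * (Complex.exp (Complex.I * (-y : ℂ) * u) *
    Complex.exp (-(t / 2 : ℂ) * (u : ℂ) ^ 2))) * hI

lemma wave_succ (t y : ℝ) (k : ℕ) (u : ℝ) :
    wave t y (k + 1) u = Complex.I * u * wave t y k u := by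
  unfold wave
  ring

lemma hasDerivAt_wave_succ (t y : ℝ) (k : ℕ) (u : ℝ) :
    HasDerivAt (wave t y (k + 1)) (Complex.I * ((k + 1) * wave t y k u - y * wave t y (k + 1) u +
      t * wave t y (k + 2) u)) u := by
  have h0 : HasDerivAt (fun u : ℝ => (Complex.I * u : ℂ)) Complex.I u := by
    simpa using (Complex.ofRealCLM.hasDerivAt (x := u)).const_mul Complex.I
  induction k with
  | zero =>
    have h := h0.mul (hasDerivAt_wave_zero t y u)
    have e : wave t y (0 + 1) = (fun u : ℝ => (Complex.I * u : ℂ)) * wave t y 0 :=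
      funext fun u => wave_succ t y 0 u
    rw [e]
    refine h.congr_deriv ?_
    rw [wave_succ t y 1, wave_succ t y 0, Pi.mul_apply]
    push_cast
    ring
  | succ k ih =>
    have h := h0.mul ih
    have e : wave t y (k + 1 + 1) = (fun u : ℝ => (Complex.I * u : ℂ)) * wave t y (k + 1) :=
      funext fun u => wave_succ t y (k + 1) u
    rw [e]
    refine h.congr_deriv ?_
    rw [wave_succ t y (k + 2), wave_succ t y (k + 1), Pi.mul_apply, wave_succ t y k]
    push_cast
    ring

lemma integral_wave_succ_succ {t : ℝ} (ht : 0 < t) (y : ℝ) (k : ℕ) :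
    (t : ℂ) * ∫ u, wave t y (k + 2) u =
      y * (∫ u, wave t y (k + 1) u) - (k + 1) * ∫ u, wave t y k u := by
  have i0 := integrable_wave ht y k
  have i1 := integrable_wave ht y (k + 1)
  have i2 := integrable_wave ht y (k + 2)
  have i01 : Integrable fun u => ((k : ℂ) + 1) * wave t y k u - y * wave t y (k + 1) u :=
    (i0.const_mul _).sub (i1.const_mul _)
  have i012 : Integrable fun u => ((k : ℂ) + 1) * wave t y k u - y * wave t y (k + 1) u +
      t * wave t y (k + 2) u := i01.add (i2.const_mul _)
  have h := integral_eq_zero_of_hasDerivAt_of_integrable (hasDerivAt_wave_succ t y k)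
    (i012.const_mul _) i1
  rw [integral_const_mul, integral_add i01 (i2.const_mul _),
    integral_sub (i0.const_mul _) (i1.const_mul _), integral_const_mul, integral_const_mul,
    integral_const_mul] at h
  have := (mul_eq_zero.1 h).resolve_left Complex.I_ne_zero
  linear_combination this

lemma integral_wave_one {t : ℝ} (ht : 0 < t) (y : ℝ) :
    (t : ℂ) * ∫ u, wave t y 1 u = y * ∫ u, wave t y 0 u := by
  have i0 := integrable_wave ht y 0
  have i1 := integrable_wave ht y 1
  have h := integral_eq_zero_of_hasDerivAt_of_integrable (hasDerivAt_wave_zero t y)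
    (((i1.const_mul _).sub (i0.const_mul _)).const_mul _) i0
  rw [integral_const_mul, integral_sub (i1.const_mul _) (i0.const_mul _), integral_const_mul,
    integral_const_mul] at h
  have := (mul_eq_zero.1 h).resolve_left Complex.I_ne_zero
  linear_combination this

lemma integral_wave_zero {t : ℝ} (ht : 0 < t) (y : ℝ) :
    ∫ u, wave t y 0 u = ((2 * Real.pi * heatKernel t y 0 : ℝ) : ℂ) := by
  unfold wave
  simp only [pow_zero, one_mul]
  rw [fourierIntegral_gaussian (by simp [ht])]
  have h1 : ((Real.pi : ℂ) / (t / 2 : ℂ)) = ((2 * Real.pi / t : ℝ) : ℂ) := by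
    push_cast
    field_simp
  have h2 : (-(-(y : ℂ)) ^ 2 / (4 * (t / 2 : ℂ))) = ((-(y - 0) ^ 2 / (2 * t) : ℝ) : ℂ) := by
    push_cast
    field_simp
    ring
  have h3 : 2 * Real.pi * (1 / Real.sqrt (2 * Real.pi * t)) = (2 * Real.pi / t) ^ (1 / 2 : ℝ) := by
    rw [← Real.sqrt_eq_rpow, Real.sqrt_div (by positivity), Real.sqrt_mul (by positivity)]
    have : Real.sqrt (2 * Real.pi) * Real.sqrt (2 * Real.pi) = 2 * Real.pi :=
      Real.mul_self_sqrt (by positivity)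
    have h4 : Real.sqrt (2 * Real.pi) ≠ 0 := by positivity
    have h5 : Real.sqrt t ≠ 0 := by positivity
    field_simp
    linarith
  rw [h1, h2, heatKernel, ← mul_assoc, h3, ← Complex.ofReal_exp, Complex.ofReal_mul,
    Complex.ofReal_cpow (by positivity)]
  norm_num

/-- The moments of `wave` satisfy the three-term recurrence of the heat polynomials. -/
lemma integral_wave {t : ℝ} (ht : 0 < t) (y : ℝ) (k : ℕ) :
    ∫ u, wave t y k u =
      ((2 * Real.pi * ((heatPoly t k).eval y * heatKernel t y 0 / t ^ k) : ℝ) : ℂ) := by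
  have ht' : (t : ℂ) ≠ 0 := by exact_mod_cast ht.ne'
  induction k using Nat.twoStepInduction with
  | zero => rw [integral_wave_zero ht]; simp [eval_heatPoly_zero]
  | one =>
    refine mul_left_cancel₀ ht' ?_
    rw [integral_wave_one ht, integral_wave_zero ht, eval_heatPoly_one]
    push_cast
    field_simp
  | more k h0 h1 =>
    refine mul_left_cancel₀ ht' ?_
    rw [integral_wave_succ_succ ht, h0, h1, eval_heatPoly_succ_succ]
    push_cast
    field_simp
    ring

lemma heatDual_eq_integral {t : ℝ} (ht : 0 < t) (y : ℝ) (k : ℕ) :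
    (heatDual t k y : ℂ) = 1 / (2 * Real.pi) * ((1 / k.factorial : ℂ) * ∫ u, wave t y k u) := by
  have : (Real.pi : ℂ) ≠ 0 := by exact_mod_cast Real.pi_ne_zero
  rw [integral_wave ht, heatDual]
  push_cast
  field_simp

/-! ### The generating function of the heat polynomials -/

/-- The `k`-th coefficient of the power series of `v ↦ exp (c * v ^ 2)`. -/
noncomputable def expSqCoeff (c : ℝ) (k : ℕ) : ℝ :=
  if Even k then c ^ (k / 2) / (k / 2).factorial else 0

lemma expSqCoeff_succ_succ (c : ℝ) (k : ℕ) :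
    ((k : ℝ) + 2) * expSqCoeff c (k + 2) = 2 * c * expSqCoeff c k := by
  unfold expSqCoeff
  by_cases h : Even k
  · obtain ⟨j, rfl⟩ := h
    have e1 : (j + j + 2) / 2 = j + 1 := by omega
    have e2 : (j + j) / 2 = j := by omega
    rw [if_pos (by simp [Nat.even_add]), if_pos (by simp), e1, e2, Nat.factorial_succ, pow_succ]
    push_cast
    field_simp
    ring
  · rw [if_neg (by simpa [Nat.even_add] using h), if_neg h]
    simp

/-- The `k`-th coefficient of the power series of `v ↦ exp (x * v + c * v ^ 2)`. -/
noncomputable def expQuadCoeff (c x : ℝ) (k : ℕ) : ℝ :=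
  ∑ p ∈ Finset.HasAntidiagonal.antidiagonal k, x ^ p.1 / p.1.factorial * expSqCoeff c p.2

lemma expQuadCoeff_succ_succ (c x : ℝ) (k : ℕ) :
    ((k : ℝ) + 2) * expQuadCoeff c x (k + 2) =
      x * expQuadCoeff c x (k + 1) + 2 * c * expQuadCoeff c x k := by
  -- compare coefficients in `(A * D)' = (x + 2 * c * X) * (A * D)`
  set A : PowerSeries ℝ := PowerSeries.mk fun k => x ^ k / k.factorial with hA
  set D : PowerSeries ℝ := PowerSeries.mk (expSqCoeff c) with hD
  have hco : ∀ k, PowerSeries.coeff k (A * D) = expQuadCoeff c x k := by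
    intro k
    rw [PowerSeries.coeff_mul, expQuadCoeff]
    simp [hA, hD]
  have hA' : PowerSeries.derivative ℝ A = PowerSeries.C x * A := by
    ext k
    rw [PowerSeries.coeff_derivative, PowerSeries.coeff_C_mul, hA, PowerSeries.coeff_mk,
      PowerSeries.coeff_mk, Nat.factorial_succ, pow_succ]
    push_cast
    field_simp
  have hD' : PowerSeries.derivative ℝ D = PowerSeries.C (2 * c) * (PowerSeries.X * D) := by
    ext k
    rw [PowerSeries.coeff_derivative, PowerSeries.coeff_C_mul]
    rcases k with _ | k
    · simp [hD, expSqCoeff]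
    · rw [PowerSeries.coeff_succ_X_mul, hD, PowerSeries.coeff_mk, PowerSeries.coeff_mk,
        ← expSqCoeff_succ_succ]
      push_cast
      ring
  have hAD : PowerSeries.derivative ℝ (A * D) =
      PowerSeries.C x * (A * D) + PowerSeries.C (2 * c) * (PowerSeries.X * (A * D)) := by
    rw [Derivation.leibniz, hA', hD', smul_eq_mul, smul_eq_mul]
    ring
  have h := congrArg (PowerSeries.coeff (k + 1)) hAD
  rw [PowerSeries.coeff_derivative, map_add, PowerSeries.coeff_C_mul, PowerSeries.coeff_C_mul,
    PowerSeries.coeff_succ_X_mul, hco, hco, hco] at h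
  rw [← h]
  push_cast
  ring

/-- `∑ B_k(t, x) v ^ k / k! = exp (x * v - t / 2 * v ^ 2)` at the level of coefficients. -/
lemma eval_heatPoly_eq (t x : ℝ) (k : ℕ) :
    (heatPoly t k).eval x = k.factorial * expQuadCoeff (-(t / 2)) x k := by
  induction k using Nat.twoStepInduction with
  | zero => simp [eval_heatPoly_zero, expQuadCoeff, expSqCoeff]
  | one =>
    simp [eval_heatPoly_one, expQuadCoeff, expSqCoeff, Finset.Nat.antidiagonal_succ]
  | more k h0 h1 =>
    have h := expQuadCoeff_succ_succ (-(t / 2)) x k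
    rw [eval_heatPoly_succ_succ, h0, h1, Nat.factorial_succ (k + 1), Nat.factorial_succ k]
    push_cast
    linear_combination (-((k : ℝ) + 1) * k.factorial) * h

lemma abs_expQuadCoeff_le (c x : ℝ) (k : ℕ) :
    |expQuadCoeff c x k| ≤ expQuadCoeff |c| |x| k := by
  unfold expQuadCoeff
  refine (Finset.abs_sum_le_sum_abs _ _).trans (Finset.sum_le_sum fun p _ => le_of_eq ?_)
  unfold expSqCoeff
  rw [abs_mul, abs_div, abs_pow, Nat.abs_cast]
  split_ifs
  · rw [abs_div, abs_pow, Nat.abs_cast]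
  · simp

lemma hasSum_expSqCoeff (c : ℝ) (v : ℂ) :
    HasSum (fun k => (expSqCoeff c k : ℂ) * v ^ k) (Complex.exp (c * v ^ 2)) := by
  rw [← add_zero (Complex.exp (c * v ^ 2))]
  refine HasSum.even_add_odd ?_ ?_
  · have h := NormedSpace.expSeries_div_hasSum_exp ((c : ℂ) * v ^ 2)
    rw [← Complex.exp_eq_exp_ℂ] at h
    refine h.congr_fun fun k => ?_
    simp only [expSqCoeff, even_two, Even.mul_right, if_true,
      Nat.mul_div_cancel_left k two_pos]
    push_cast
    rw [mul_pow, pow_mul]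
    ring
  · have : ∀ k : ℕ, (expSqCoeff c (2 * k + 1) : ℂ) * v ^ (2 * k + 1) = 0 := by
      intro k
      simp [expSqCoeff]
    simp only [this]
    exact hasSum_zero

lemma hasSum_expQuadCoeff (c x : ℝ) (v : ℂ) :
    HasSum (fun k => (expQuadCoeff c x k : ℂ) * v ^ k) (Complex.exp (x * v + c * v ^ 2)) := by
  have h1 := NormedSpace.expSeries_div_hasSum_exp ((x : ℂ) * v)
  rw [← Complex.exp_eq_exp_ℂ] at h1
  have h2 := hasSum_expSqCoeff c v
  have s1 := h1.summable.norm
  have s2 := h2.summable.norm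
  have h := (summable_norm_sum_mul_antidiagonal_of_summable_norm s1 s2).of_norm
  have h' := tsum_mul_tsum_eq_tsum_sum_antidiagonal_of_summable_norm s1 s2
  rw [h1.tsum_eq, h2.tsum_eq, ← Complex.exp_add] at h'
  rw [h']
  refine h.hasSum.congr_fun fun k => ?_
  unfold expQuadCoeff
  push_cast
  rw [Finset.sum_mul]
  refine Finset.sum_congr rfl fun p hp => ?_
  rw [← Finset.HasAntidiagonal.mem_antidiagonal.1 hp, mul_pow, pow_add]
  ring

lemma hasSum_expQuadCoeff_real (c x r : ℝ) :
    HasSum (fun k => expQuadCoeff c x k * r ^ k) (Real.exp (x * r + c * r ^ 2)) := by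
  rw [← Complex.hasSum_ofReal]
  have h := hasSum_expQuadCoeff c x r
  push_cast
  exact h

/-! ### The truncated generating function -/

/-- The first `N` terms of the power series of `exp (x * v - s / 2 * v ^ 2)` at `v = i u`. -/
noncomputable def genTrunc (N : ℕ) (s x u : ℝ) : ℂ :=
  ∑ k ∈ Finset.range N, (expQuadCoeff (-(s / 2)) x k : ℂ) * (Complex.I * u) ^ k

lemma continuous_genTrunc (N : ℕ) (s x : ℝ) : Continuous (genTrunc N s x) := by
  unfold genTrunc
  fun_prop

lemma heatProj_eq_integral (N : ℕ) {t : ℝ} (ht : 0 < t) (y s x : ℝ) :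
    (heatProj N t y s x : ℂ) = 1 / (2 * Real.pi) * ∫ u : ℝ, genTrunc N s x u * wave t y 0 u := by
  have e : ∀ u : ℝ, genTrunc N s x u * wave t y 0 u =
      ∑ k ∈ Finset.range N, (expQuadCoeff (-(s / 2)) x k : ℂ) * wave t y k u := by
    intro u
    rw [genTrunc, Finset.sum_mul]
    refine Finset.sum_congr rfl fun k _ => ?_
    simp [wave, mul_assoc]
  simp only [e]
  rw [integral_finsetSum _ fun k _ => (integrable_wave ht y k).const_mul _, Finset.mul_sum, heatProj]
  push_cast
  refine Finset.sum_congr rfl fun k _ => ?_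
  have : (k.factorial : ℂ) ≠ 0 := by exact_mod_cast k.factorial_ne_zero
  rw [integral_const_mul, heatDual_eq_integral ht, eval_heatPoly_eq]
  push_cast
  field_simp

/-- Termwise majorant: the series with `|x|` in place of `x` and with the opposite sign of `s`. -/
lemma norm_genTrunc_term_le {s : ℝ} (hs : 0 ≤ s) (x u : ℝ) (k : ℕ) :
    ‖(expQuadCoeff (-(s / 2)) x k : ℂ) * (Complex.I * u) ^ k‖ ≤
      expQuadCoeff (s / 2) |x| k * |u| ^ k := by
  rw [norm_mul, norm_pow, norm_mul, Complex.norm_I, one_mul, Complex.norm_real, Complex.norm_real,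
    Real.norm_eq_abs, Real.norm_eq_abs]
  refine mul_le_mul_of_nonneg_right ?_ (by positivity)
  have h := abs_expQuadCoeff_le (-(s / 2)) x k
  rwa [abs_neg, abs_of_nonneg (by positivity : 0 ≤ s / 2)] at h

lemma expQuadCoeff_abs_nonneg {s : ℝ} (hs : 0 ≤ s) (x : ℝ) (k : ℕ) :
    0 ≤ expQuadCoeff (s / 2) |x| k := by
  have h := abs_expQuadCoeff_le (s / 2) x k
  rw [abs_of_nonneg (by positivity : 0 ≤ s / 2)] at h
  exact (abs_nonneg _).trans h

lemma sum_expQuadCoeff_le {s r : ℝ} (hs : 0 ≤ s) (hr : 0 ≤ r) (x : ℝ) (N : ℕ) :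
    ∑ k ∈ Finset.range N, expQuadCoeff (s / 2) |x| k * r ^ k ≤ Real.exp (|x| * r + s / 2 * r ^ 2) :=
  sum_le_hasSum _ (fun k _ => mul_nonneg (expQuadCoeff_abs_nonneg hs x k) (by positivity))
    (hasSum_expQuadCoeff_real (s / 2) |x| r)

lemma norm_genTrunc_le {s : ℝ} (hs : 0 ≤ s) (N : ℕ) (x u : ℝ) :
    ‖genTrunc N s x u‖ ≤ Real.exp (|x| * |u| + s / 2 * u ^ 2) := by
  refine (norm_sum_le _ _).trans ((Finset.sum_le_sum fun k _ =>
    norm_genTrunc_term_le hs x u k).trans ?_)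
  simpa using sum_expQuadCoeff_le hs (abs_nonneg u) x N

/-- For `1 ≤ |u|` the terms `k < N` are at most `|u| ^ N` times the majorant at `1`. -/
lemma norm_genTrunc_le_of_one_le {s : ℝ} (hs : 0 ≤ s) (N : ℕ) (x : ℝ) {u : ℝ} (hu : 1 ≤ |u|) :
    ‖genTrunc N s x u‖ ≤ |u| ^ N * Real.exp (|x| + s / 2) := by
  refine (norm_sum_le _ _).trans ((Finset.sum_le_sum fun k hk =>
    (norm_genTrunc_term_le hs x u k).trans (mul_le_mul_of_nonneg_left
      (pow_le_pow_right₀ hu (Finset.mem_range.1 hk).le) (expQuadCoeff_abs_nonneg hs x k))).trans ?_)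
  rw [← Finset.sum_mul, mul_comm]
  refine mul_le_mul_of_nonneg_left ?_ (by positivity)
  simpa using sum_expQuadCoeff_le hs zero_le_one x N

/-- For `|u| ≤ 1` the tail of the series is at most `|u| ^ N` times the majorant at `1`. -/
lemma norm_genTrunc_sub_le {s : ℝ} (hs : 0 ≤ s) (N : ℕ) (x : ℝ) {u : ℝ} (hu : |u| ≤ 1) :
    ‖genTrunc N s x u - Complex.exp (x * (Complex.I * u) + (-(s / 2) : ℝ) * (Complex.I * u) ^ 2)‖ ≤
      |u| ^ N * Real.exp (|x| + s / 2) := by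
  have h := hasSum_expQuadCoeff (-(s / 2)) x (Complex.I * u)
  have h1 := (hasSum_nat_add_iff' N).2 h
  have h2 : Summable fun k => expQuadCoeff (s / 2) |x| (k + N) := by
    have := (hasSum_expQuadCoeff_real (s / 2) |x| 1).summable
    simp only [one_pow, mul_one] at this
    exact (summable_nat_add_iff N).2 this
  have h3 : ∑' k, expQuadCoeff (s / 2) |x| (k + N) ≤ Real.exp (|x| + s / 2) := by
    have h4 := hasSum_expQuadCoeff_real (s / 2) |x| 1
    simp only [one_pow, mul_one] at h4
    rw [← h4.tsum_eq, ← h4.summable.sum_add_tsum_nat_add N]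
    have : 0 ≤ ∑ k ∈ Finset.range N, expQuadCoeff (s / 2) |x| k :=
      Finset.sum_nonneg fun k _ => expQuadCoeff_abs_nonneg hs x k
    linarith
  rw [norm_sub_rev]
  have h5 : ∀ k, ‖(expQuadCoeff (-(s / 2)) x (k + N) : ℂ) * (Complex.I * u) ^ (k + N)‖ ≤
      |u| ^ N * expQuadCoeff (s / 2) |x| (k + N) := by
    intro k
    refine (norm_genTrunc_term_le hs x u (k + N)).trans ?_
    rw [mul_comm]
    refine mul_le_mul_of_nonneg_right ?_ (expQuadCoeff_abs_nonneg hs x _)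
    exact pow_le_pow_of_le_one (abs_nonneg u) hu (Nat.le_add_left N k)
  rw [genTrunc, ← h1.tsum_eq]
  refine (tsum_of_norm_bounded (h2.mul_left _).hasSum h5).trans ?_
  rw [tsum_mul_left]
  exact mul_le_mul_of_nonneg_left h3 (by positivity)

/-! ### Asymptotics of the kernel -/

lemma norm_wave_zero (t y u : ℝ) : ‖wave t y 0 u‖ = Real.exp (-(t / 2) * u ^ 2) := by
  rw [norm_wave]; simp

/-- The function `r ↦ r * exp ((1 - r ^ 2) / 2)` has its strict maximum `1` at `r = 1`. -/
lemma abs_mul_exp_lt_one {u : ℝ} (hu : |u| ≠ 1) : |u| * Real.exp ((1 - u ^ 2) / 2) < 1 := by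
  have h1 : u ^ 2 - 1 ≠ 0 := by
    intro h
    apply hu
    have : |u| ^ 2 = 1 := by rw [sq_abs]; linarith
    exact (pow_eq_one_iff_of_nonneg (abs_nonneg u) two_ne_zero).1 this
  have h2 := Real.add_one_lt_exp h1
  have h3 : (|u| * Real.exp ((1 - u ^ 2) / 2)) ^ 2 < 1 ^ 2 := by
    rw [mul_pow, sq_abs, ← Real.exp_nat_mul]
    have e : ((2 : ℕ) : ℝ) * ((1 - u ^ 2) / 2) = -(u ^ 2 - 1) := by push_cast; ring
    rw [e, Real.exp_neg, one_pow, ← div_eq_mul_inv, div_lt_one (Real.exp_pos _)]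
    linarith
  exact lt_of_pow_lt_pow_left₀ 2 zero_le_one h3

lemma pow_mul_exp_eq (N : ℕ) (a σ σ' u : ℝ) :
    |u| ^ N * Real.exp (a + (N + 2 * σ) / 2) * Real.exp (-((N + 2 * σ') / 2) * u ^ 2) =
      Real.exp (a + σ - σ' * u ^ 2) * (|u| * Real.exp ((1 - u ^ 2) / 2)) ^ N := by
  rw [mul_pow, ← Real.exp_nat_mul, mul_assoc, ← Real.exp_add, mul_left_comm, ← Real.exp_add]
  congr 2
  ring

lemma tendsto_pow_mul_exp (a σ σ' : ℝ) {u : ℝ} (hu : |u| ≠ 1) :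
    Filter.Tendsto (fun N : ℕ => |u| ^ N * Real.exp (a + (N + 2 * σ) / 2) *
      Real.exp (-((N + 2 * σ') / 2) * u ^ 2)) Filter.atTop (nhds 0) := by
  simp only [pow_mul_exp_eq]
  rw [← mul_zero (Real.exp (a + σ - σ' * u ^ 2))]
  exact (tendsto_pow_atTop_nhds_zero_of_lt_one (by positivity) (abs_mul_exp_lt_one hu)).const_mul _

/-- The Fourier integrand concentrates on the frequencies in `[-1, 1]`. -/
lemma tendsto_genTrunc_mul_wave {σ : ℝ} (hσ : 0 ≤ σ) (σ' x y : ℝ) {u : ℝ} (hu : |u| ≠ 1) :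
    Filter.Tendsto (fun N : ℕ => genTrunc N (N + 2 * σ) x u * wave (N + 2 * σ') y 0 u)
      Filter.atTop (nhds (if |u| < 1 then
        Complex.exp (((σ - σ') * u ^ 2 : ℝ) + (u * (x - y) : ℝ) * Complex.I) else 0)) := by
  have hz := tendsto_pow_mul_exp |x| σ σ' hu
  split_ifs with h
  · rw [tendsto_iff_norm_sub_tendsto_zero]
    refine squeeze_zero (fun _ => norm_nonneg _) (fun N => ?_) hz
    have e : Complex.exp (((σ - σ') * u ^ 2 : ℝ) + (u * (x - y) : ℝ) * Complex.I) =
        Complex.exp (x * (Complex.I * u) + (-((N + 2 * σ) / 2) : ℝ) * (Complex.I * u) ^ 2) *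
          wave (N + 2 * σ') y 0 u := by
      unfold wave
      rw [pow_zero, one_mul, ← Complex.exp_add, ← Complex.exp_add]
      congr 1
      push_cast
      linear_combination (u ^ 2 * ((N : ℂ) + 2 * σ) / 2) * Complex.I_sq
    rw [e, ← sub_mul, norm_mul, norm_wave_zero]
    exact mul_le_mul_of_nonneg_right (norm_genTrunc_sub_le (by positivity) N x h.le) (by positivity)
  · rw [tendsto_zero_iff_norm_tendsto_zero]
    refine squeeze_zero (fun _ => norm_nonneg _) (fun N => ?_) hz
    rw [norm_mul, norm_wave_zero]
    exact mul_le_mul_of_nonneg_right (norm_genTrunc_le_of_one_le (by positivity) N x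
      (not_lt.1 h)) (by positivity)

/-- The integrable majorant. For `|u| ≤ 2` the full majorant series suffices; for larger `|u|` the
factor `(|u| * exp ((1 - u ^ 2) / 2)) ^ N ≤ exp (-N * u ^ 2 / 8)` provides the decay. -/
lemma norm_genTrunc_mul_wave_le {σ σ' : ℝ} (hσ : 0 ≤ σ) (hσ' : 0 ≤ σ') (x y : ℝ) {N : ℕ}
    (hN : 8 ≤ N) (u : ℝ) :
    ‖genTrunc N (N + 2 * σ) x u * wave (N + 2 * σ') y 0 u‖ ≤
      Real.exp (2 * |x| + 4 * σ + 4) * Real.exp (-1 * u ^ 2) := by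
  rw [norm_mul, norm_wave_zero, ← Real.exp_add]
  by_cases hu : |u| ≤ 2
  · have hu2 : u ^ 2 ≤ 4 := by rw [← sq_abs]; nlinarith [abs_nonneg u]
    refine (mul_le_mul_of_nonneg_right (norm_genTrunc_le (by positivity) N x u)
      (Real.exp_pos _).le).trans ?_
    rw [← Real.exp_add, Real.exp_le_exp]
    nlinarith [mul_le_mul_of_nonneg_left hu (abs_nonneg x), mul_le_mul_of_nonneg_left hu2 hσ,
      mul_nonneg hσ' (sq_nonneg u)]
  · push Not at hu
    have hu2 : 4 ≤ u ^ 2 := by rw [← sq_abs]; nlinarith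
    have hq : |u| * Real.exp ((1 - u ^ 2) / 2) ≤ Real.exp (-(u ^ 2 / 8)) := by
      have h1 : |u| ≤ Real.exp (u ^ 2 / 4) := by
        have := Real.add_one_le_exp (u ^ 2 / 4)
        nlinarith [sq_nonneg (|u| - 2), sq_abs u]
      refine (mul_le_mul_of_nonneg_right h1 (Real.exp_pos _).le).trans ?_
      rw [← Real.exp_add, Real.exp_le_exp]
      linarith
    refine (mul_le_mul_of_nonneg_right (norm_genTrunc_le_of_one_le (by positivity) N x
      (by linarith : 1 ≤ |u|)) (Real.exp_pos _).le).trans ?_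
    rw [pow_mul_exp_eq]
    refine (mul_le_mul_of_nonneg_left (pow_le_pow_left₀ (by positivity) hq N)
      (Real.exp_pos _).le).trans ?_
    rw [← Real.exp_nat_mul, ← Real.exp_add, Real.exp_le_exp]
    have hN' : (8 : ℝ) ≤ N := by exact_mod_cast hN
    nlinarith [mul_le_mul_of_nonneg_right hN' (sq_nonneg u), abs_nonneg x,
      mul_nonneg hσ' (sq_nonneg u)]

/-- Integrals over a symmetric set of frequencies fold onto the half-line; the predicate `P`
describes the admitted values of `|u|`. -/
lemma re_integral_cexp (P : ℝ → Prop) [DecidablePred P] (c d : ℝ)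
    (hint : Integrable fun u : ℝ => if P |u| then
        Complex.exp ((c * u ^ 2 : ℝ) + (u * d : ℝ) * Complex.I) else 0) :
    (∫ u : ℝ, if P |u| then
        Complex.exp ((c * u ^ 2 : ℝ) + (u * d : ℝ) * Complex.I) else 0).re =
      2 * ∫ u in Set.Ioi (0 : ℝ), if P u then Real.exp (c * u ^ 2) * Real.cos (u * d) else 0 := by
  rw [← integral_comp_abs (f := fun u => if P u then Real.exp (c * u ^ 2) * Real.cos (u * d) else 0)]
  have h := integral_re hint
  simp only [RCLike.re_to_complex] at h
  rw [← h]
  refine integral_congr_ae (Filter.Eventually.of_forall fun u => ?_)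
  have hc : Real.cos (|u| * d) = Real.cos (u * d) := by
    rcases abs_choice u with h | h <;> rw [h]
    rw [neg_mul, Real.cos_neg]
  simp only
  split_ifs
  · rw [Complex.exp_re, sq_abs, hc]
    simp [-Complex.ofReal_pow]
  · simp

/-- The limit of the rank-`N` part of the kernel. -/
lemma tendsto_heatProj {σ σ' : ℝ} (hσ : 0 ≤ σ) (hσ' : 0 ≤ σ') (x y : ℝ) :
    Filter.Tendsto (fun N : ℕ => heatProj N (N + 2 * σ') y (N + 2 * σ) x) Filter.atTop
      (nhds (1 / Real.pi *
        ∫ u in (0 : ℝ)..1, Real.exp ((σ - σ') * u ^ 2) * Real.cos (u * (y - x)))) := by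
  set f : ℝ → ℂ := fun u => if |u| < 1 then
        Complex.exp (((σ - σ') * u ^ 2 : ℝ) + (u * (x - y) : ℝ) * Complex.I) else 0 with hf
  have hdom : Filter.Tendsto (fun N : ℕ => ∫ u : ℝ, genTrunc N (N + 2 * σ) x u *
      wave (N + 2 * σ') y 0 u) Filter.atTop (nhds (∫ u, f u)) := by
    refine tendsto_integral_filter_of_dominated_convergence
      (fun u => Real.exp (2 * |x| + 4 * σ + 4) * Real.exp (-1 * u ^ 2)) ?_ ?_ ?_ ?_
    · exact Filter.Eventually.of_forall fun N =>
        ((continuous_genTrunc _ _ _).mul (continuous_wave _ _ _)).aestronglyMeasurable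
    · filter_upwards [Filter.eventually_ge_atTop 8] with N hN
      exact Filter.Eventually.of_forall (norm_genTrunc_mul_wave_le hσ hσ' x y hN)
    · exact (integrable_exp_neg_mul_sq one_pos).const_mul _
    · have h1 : ∀ᵐ u : ℝ, u ∉ ({1, -1} : Set ℝ) :=
        (Set.toFinite ({1, -1} : Set ℝ)).countable.ae_notMem _
      filter_upwards [h1] with u hu
      refine tendsto_genTrunc_mul_wave hσ σ' x y fun h => hu ?_
      rcases (abs_eq zero_le_one).1 h with h | h <;> simp [h]
  have hfint : Integrable f := by
    have hcont : Continuous fun u : ℝ =>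
        Complex.exp (((σ - σ') * u ^ 2 : ℝ) + (u * (x - y) : ℝ) * Complex.I) := by fun_prop
    have h := (hcont.integrableOn_Icc (a := -1) (b := 1) (μ := volume)).mono_set
      Set.Ioo_subset_Icc_self
    rw [← integrable_indicator_iff measurableSet_Ioo] at h
    refine h.congr (Filter.Eventually.of_forall fun u => ?_)
    simp only [hf, Set.indicator_apply, Set.mem_Ioo, abs_lt]
  have hre : (∫ u, f u).re = 2 * ∫ u in (0 : ℝ)..1,
      Real.exp ((σ - σ') * u ^ 2) * Real.cos (u * (y - x)) := by
    rw [hf, re_integral_cexp (fun u => u < 1) (σ - σ') (x - y) hfint,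
      intervalIntegral.integral_of_le zero_le_one, integral_Ioc_eq_integral_Ioo,
      ← Set.Ioi_inter_Iio, ← setIntegral_indicator measurableSet_Iio]
    congr 1
    refine integral_congr_ae (Filter.Eventually.of_forall fun u => ?_)
    simp only [Set.indicator_apply, Set.mem_Iio]
    rw [← Real.cos_neg, show -(u * (x - y)) = u * (y - x) by ring]
  have h2 := (Complex.continuous_re.tendsto _).comp (hdom.const_mul (1 / (2 * Real.pi : ℂ)))
  have e : (1 / (2 * Real.pi) * ∫ u, f u : ℂ).re = 1 / Real.pi *
      ∫ u in (0 : ℝ)..1, Real.exp ((σ - σ') * u ^ 2) * Real.cos (u * (y - x)) := by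
    rw [show (1 / (2 * Real.pi) : ℂ) = ((1 / (2 * Real.pi) : ℝ) : ℂ) by push_cast; rfl,
      Complex.re_ofReal_mul, hre]
    ring
  rw [e] at h2
  refine h2.congr' ?_
  filter_upwards [Filter.eventually_ge_atTop 1] with N hN
  have hN' : (1 : ℝ) ≤ N := by exact_mod_cast hN
  rw [Function.comp_apply, ← heatProj_eq_integral N (by positivity : (0 : ℝ) < N + 2 * σ') y,
    Complex.ofReal_re]

lemma integrable_exp_mul_cos {a : ℝ} (ha : 0 < a) (d : ℝ) :
    Integrable fun u : ℝ => Real.exp (-a * u ^ 2) * Real.cos (u * d) := by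
  refine (integrable_exp_neg_mul_sq ha).mono' (by fun_prop)
    (Filter.Eventually.of_forall fun u => ?_)
  rw [norm_mul, Real.norm_eq_abs, Real.abs_exp]
  exact mul_le_of_le_one_right (Real.exp_pos _).le (Real.abs_cos_le_one _)

lemma heatKernel_eq_integral {a : ℝ} (ha : 0 < a) (y x : ℝ) :
    heatKernel (2 * a) y x =
      1 / Real.pi * ∫ u in Set.Ioi (0 : ℝ), Real.exp (-a * u ^ 2) * Real.cos (u * (y - x)) := by
  have h := integral_wave_zero (by positivity : 0 < 2 * a) (x - y)
  have e : ∀ u : ℝ, wave (2 * a) (x - y) 0 u = if (fun _ : ℝ => True) |u| then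
      Complex.exp ((-a * u ^ 2 : ℝ) + (u * (y - x) : ℝ) * Complex.I) else 0 := by
    intro u
    simp only [wave, if_true, pow_zero, one_mul, ← Complex.exp_add]
    congr 1
    push_cast
    ring
  have hint := (integrable_wave (by positivity : 0 < 2 * a) (x - y) 0)
  have h2 := re_integral_cexp (fun _ => True) (-a) (y - x)
    (hint.congr (Filter.Eventually.of_forall e))
  simp only [e] at h
  rw [h, Complex.ofReal_re] at h2
  have h3 : heatKernel (2 * a) (x - y) 0 = heatKernel (2 * a) y x := by
    unfold heatKernel
    congr 3
    ring
  simp only [if_true, h3] at h2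
  rw [one_div, ← div_eq_inv_mul, eq_div_iff Real.pi_ne_zero]
  linarith

lemma integral_cos_eq_sinc (d : ℝ) : ∫ u in (0 : ℝ)..1, Real.cos (u * d) = Real.sinc d := by
  by_cases hd : d = 0
  · simp [hd]
  · rw [intervalIntegral.integral_comp_mul_right (fun u => Real.cos u) hd, Real.sinc_of_ne_zero hd]
    simp
    field_simp

/-- Convergence of the extended Hermite kernel to the extended sine kernel. -/
theorem tendsto_corrKernel {σ σ' : ℝ} (hσ : 0 ≤ σ) (hσ' : 0 ≤ σ') (x y : ℝ) :
    Filter.Tendsto (fun N : ℕ => corrKernel N (N + 2 * σ') y (N + 2 * σ) x) Filter.atTop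
      (nhds (sineKernel σ' y σ x)) := by
  have h := tendsto_heatProj hσ hσ' x y
  have hlt : ∀ N : ℕ, (N : ℝ) + 2 * σ < N + 2 * σ' ↔ σ < σ' := fun N => by
    constructor <;> intro h <;> linarith
  unfold corrKernel sineKernel
  simp only [hlt]
  rcases lt_trichotomy σ' σ with hs | hs | hs
  · simpa only [hs, hs.not_gt, if_true, if_false, sub_zero] using h
  · subst hs
    simp only [lt_irrefl, if_true, if_false, sub_zero]
    simp only [sub_self, zero_mul, Real.exp_zero, one_mul, integral_cos_eq_sinc] at h
    rwa [one_div_mul_eq_div] at h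
  · simp only [hs, hs.not_gt, hs.ne', if_true, if_false]
    have ha : 0 < σ' - σ := sub_pos.2 hs
    have e : ∀ N : ℕ, heatKernel ((N : ℝ) + 2 * σ' - (N + 2 * σ)) y x =
        heatKernel (2 * (σ' - σ)) y x := fun N => by congr 1; ring
    simp only [e]
    refine (h.sub_const _).trans (le_of_eq ?_)
    congr 1
    have hint := integrable_exp_mul_cos ha (y - x)
    have hsplit := intervalIntegral.integral_interval_add_Ioi (a := (0 : ℝ)) (b := 1)
      hint.integrableOn hint.integrableOn
    rw [heatKernel_eq_integral ha, ← hsplit, show σ - σ' = -(σ' - σ) by ring]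
    ring

/-! ### Correlation functions as determinants -/

/-- Currying preserves Lebesgue measure on finite products. -/
lemma measurePreserving_piCurry {ι : Type*} [Fintype ι] (κ : ι → Type*) [∀ i, Fintype (κ i)] :
    MeasurePreserving (MeasurableEquiv.piCurry fun (i : ι) (_ : κ i) => ℝ) := by
  suffices h : MeasurePreserving (MeasurableEquiv.piCurry fun (i : ι) (_ : κ i) => ℝ).symm from
    h.symm
  refine ⟨MeasurableEquiv.measurable _, ?_⟩
  rw [volume_pi (ι := (i : ι) × κ i)]
  refine (Measure.pi_eq fun s _ => ?_).symm
  rw [MeasurableEquiv.map_apply]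
  have e : (MeasurableEquiv.piCurry fun (i : ι) (_ : κ i) => ℝ).symm ⁻¹' (Set.univ.pi s) =
      Set.univ.pi fun i => Set.univ.pi fun j => s ⟨i, j⟩ := by
    ext f
    simp only [Set.mem_preimage, Set.mem_pi, Set.mem_univ, true_implies, Sigma.forall]
    rfl
  rw [e, volume_pi, Measure.pi_pi]
  simp only [volume_pi, Measure.pi_pi, Fintype.prod_sigma]

/-- At each time the `N` particles are split into `n m` fixed ones and the remaining ones. -/
def splitParticles {M N : ℕ} {n : Fin (M + 1) → ℕ} (hN : ∀ m, n m ≤ N) :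
    ((m : Fin (M + 1)) × Fin (n m)) ⊕ ((m : Fin (M + 1)) × Fin (N - n m)) ≃
      Fin (M + 1) × Fin N where
  toFun := Sum.elim (fun a => (a.1, Fin.castLE (hN a.1) a.2))
    (fun b => (b.1, ⟨n b.1 + b.2, by have := hN b.1; omega⟩))
  invFun p := if h : (p.2 : ℕ) < n p.1 then Sum.inl ⟨p.1, ⟨p.2, h⟩⟩
    else Sum.inr ⟨p.1, ⟨p.2 - n p.1, by omega⟩⟩
  left_inv p := by
    rcases p with ⟨m, j⟩ | ⟨m, j⟩
    · simp
    · simp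
  right_inv p := by
    obtain ⟨m, i⟩ := p
    by_cases h : (i : ℕ) < n m
    · simp [h]
    · simp only [h, dif_neg, not_false_eq_true, Sum.elim_inr, Prod.mk.injEq, true_and]
      ext
      simp only
      omega

lemma append_comp_splitParticles {M N : ℕ} {n : Fin (M + 1) → ℕ} (hN : ∀ m, n m ≤ N)
    (x : (m : Fin (M + 1)) → Fin (n m) → ℝ) (y : (m : Fin (M + 1)) → Fin (N - n m) → ℝ) :
    (fun p : Fin (M + 1) × Fin N => append (x p.1) (y p.1) p.2) ∘ splitParticles hN =
      Sum.elim (fun a => x a.1 a.2) (fun b => y b.1 b.2) := by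
  funext p
  rcases p with ⟨m, j⟩ | ⟨m, j⟩ <;> simp [splitParticles, append]

lemma card_filter_sigma_fst {ι : Type*} [Fintype ι] [DecidableEq ι] (n : ι → ℕ) (m : ι) :
    (Finset.univ.filter fun a : (i : ι) × Fin (n i) => a.1 = m).card = n m := by
  rw [Finset.card_filter, Fintype.sum_sigma, Finset.sum_eq_single m]
  · simp
  · intro i _ hi
    simp [hi]
  · simp

/-- The correlation functions at finite `N` are determinants of the extended Hermite kernel. -/
theorem integrable_and_corr_eq_det {M N : ℕ} {n : Fin (M + 1) → ℕ} (hN : ∀ m, n m ≤ N)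
    {t : Fin (M + 1) → ℝ} (hpos : ∀ m, 0 < t m) (ht : StrictMono t)
    (x : (m : Fin (M + 1)) → Fin (n m) → ℝ) :
    Integrable (fun y : (m : Fin (M + 1)) → Fin (N - n m) → ℝ =>
        multitimeDensity t (fun m => append (x m) (y m))) ∧
      corr N n t x = (corrMatrix N (fun a : (m : Fin (M + 1)) × Fin (n m) => t a.1)
        (fun a => x a.1 a.2)).det := by
  obtain ⟨C, δ, hδ, hbound⟩ := exists_bound_multitimeDensity (N := N) (hpos 0) ht
  set k := Fintype.card ((m : Fin (M + 1)) × Fin (N - n m)) with hk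
  let e : Fin k ≃ (m : Fin (M + 1)) × Fin (N - n m) := (Fintype.equivFin _).symm
  let E : ((m : Fin (M + 1)) × Fin (n m)) ⊕ Fin k ≃ Fin (M + 1) × Fin N :=
    (Equiv.sumCongr (Equiv.refl _) e).trans (splitParticles hN)
  let τ : ((m : Fin (M + 1)) × Fin (n m)) → Fin (M + 1) := Sigma.fst
  let τ' : Fin k → Fin (M + 1) := fun i => (e i).1
  have hfst : ∀ p, (E p).1 = Sum.elim τ τ' p := by
    rintro (p | p) <;> rfl
  have hT : (fun p : Fin (M + 1) × Fin N => t p.1) ∘ E = t ∘ Sum.elim τ τ' := by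
    funext p
    simp only [Function.comp_apply, hfst]
  have hdens : ∀ w : ((m : Fin (M + 1)) × Fin (n m)) ⊕ Fin k → ℝ,
      (corrMatrix N (t ∘ Sum.elim τ τ') w).det =
        multitimeDensity t (fun m j => w (E.symm (m, j))) := by
    intro w
    rw [← det_corrMatrix_eq_multitimeDensity (hpos 0) ht, ← det_corrMatrix_comp N E, hT]
    congr 2
    funext p
    simp
  have hb : ∀ w : ((m : Fin (M + 1)) × Fin (n m)) ⊕ Fin k → ℝ,
      |(corrMatrix N (t ∘ Sum.elim τ τ') w).det| ≤ C * ∏ p, Real.exp (-δ * w p ^ 2) := by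
    intro w
    rw [hdens]
    refine (hbound _).trans (le_of_eq ?_)
    rw [← Equiv.prod_comp E]
    simp
  have hg : Integrable fun z : ℝ => Real.exp (-δ * z ^ 2) := integrable_exp_neg_mul_sq hδ
  have hcard' : ∀ m, (Finset.univ.filter fun i => τ' i = m).card = N - n m := by
    intro m
    rw [← card_filter_sigma_fst (fun m => N - n m) m, Finset.card_filter, Finset.card_filter]
    exact Equiv.sum_comp e (fun b => if b.1 = m then 1 else 0)
  have hc : ∀ m, (Finset.univ.filter fun a => τ a = m).card +
      (Finset.univ.filter fun i => τ' i = m).card = N := by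
    intro m
    rw [hcard', card_filter_sigma_fst n m]
    have := hN m
    omega
  -- `Ψ` identifies a single list of free coordinates with the families indexed by the times
  let Ψ : (Fin k → ℝ) ≃ᵐ ((m : Fin (M + 1)) → Fin (N - n m) → ℝ) :=
    (MeasurableEquiv.piCongrLeft (fun _ => ℝ) e).trans
      (MeasurableEquiv.piCurry fun (m : Fin (M + 1)) (_ : Fin (N - n m)) => ℝ)
  have hΨ : MeasurePreserving Ψ :=
    (measurePreserving_piCurry fun m => Fin (N - n m)).comp
      (volume_measurePreserving_piCongrLeft (fun _ => ℝ) e)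
  have hΨe : ∀ (y : Fin k → ℝ) (i : Fin k), Ψ y (e i).1 (e i).2 = y i := fun y i =>
    Equiv.piCongrLeft_apply_apply (fun _ => ℝ) e y i
  have hval : ∀ y : Fin k → ℝ, multitimeDensity t (fun m => append (x m) (Ψ y m)) =
      (corrMatrix N (t ∘ Sum.elim τ τ') (Sum.elim (fun a => x a.1 a.2) y)).det := by
    intro y
    rw [← det_corrMatrix_eq_multitimeDensity (hpos 0) ht, ← det_corrMatrix_comp N E, hT]
    congr 2
    funext p
    have h := congrFun (append_comp_splitParticles hN x (Ψ y))
      (Equiv.sumCongr (Equiv.refl _) e p)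
    refine h.trans ?_
    rcases p with p | p
    · rfl
    · exact hΨe y p
  have hint : Integrable fun y : Fin k → ℝ =>
      (corrMatrix N (t ∘ Sum.elim τ τ') (Sum.elim (fun a => x a.1 a.2) y)).det := by
    refine integrable_of_abs_le_prod
      (C := C * ∏ a : (m : Fin (M + 1)) × Fin (n m), Real.exp (-δ * x a.1 a.2 ^ 2))
      ((continuous_det_corrMatrix N _).comp ?_) hg fun y => ?_
    · refine continuous_pi fun p => ?_
      rcases p with p | p
      · exact continuous_const
      · exact continuous_apply p
    · refine (hb _).trans (le_of_eq ?_)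
      rw [Fintype.prod_sum_type, mul_assoc]
      rfl
  constructor
  · rw [← hΨ.integrable_comp_emb (MeasurableEquiv.measurableEmbedding _)]
    exact hint.congr (Filter.Eventually.of_forall fun y => (hval y).symm)
  · unfold corr
    rw [integral_mul_const, ← hΨ.integral_comp']
    simp only [hval]
    rw [integral_det_corrMatrix hpos ht.injective hg τ (fun a => x a.1 a.2) τ' hb hc]
    simp only [hcard']
    rw [mul_right_comm, ← Finset.prod_mul_distrib]
    rw [Finset.prod_eq_one fun m _ => mul_one_div_cancel (by positivity), one_mul]
    rfl

end NoncollidingBM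

theorem mainTheorem2 (M : ℕ) (n : Fin (M + 1) → ℕ) (hn : ∀ m, 0 < n m)
    (s : Fin (M + 1) → ℝ) (hs0 : s 0 = 0) (hs : StrictMono s)
    (x : (m : Fin (M + 1)) → Fin (n m) → ℝ) :
    (∀ N : ℕ, (∀ m, n m ≤ N) →
      MeasureTheory.Integrable
        (fun y : (m : Fin (M + 1)) → Fin (N - n m) → ℝ =>
          NoncollidingBM.multitimeDensity (fun m => (N : ℝ) + 2 * s m)
            (fun m => NoncollidingBM.append (x m) (y m)))) ∧
    Filter.Tendsto
      (fun N : ℕ => NoncollidingBM.corr N n (fun m => (N : ℝ) + 2 * s m) x)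
      Filter.atTop
      (nhds (Matrix.det (Matrix.of fun a b : (Σ m : Fin (M + 1), Fin (n m)) =>
        NoncollidingBM.sineKernel (s a.1) (x a.1 a.2) (s b.1) (x b.1 b.2)))) := by
  have hs' : ∀ m, 0 ≤ s m := fun m => hs0 ▸ hs.monotone (Fin.zero_le m)
  have hmono : ∀ N : ℕ, StrictMono fun m => (N : ℝ) + 2 * s m := fun N a b hab => by
    have := hs hab
    simp only
    linarith
  have key := fun (N : ℕ) (hN : ∀ m, n m ≤ N) =>
    NoncollidingBM.integrable_and_corr_eq_det hN (t := fun m => (N : ℝ) + 2 * s m)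
      (fun m => by
        have h1 : (1 : ℝ) ≤ N := by exact_mod_cast (hn 0).trans_le (hN 0)
        have := hs' m
        positivity) (hmono N) x
  refine ⟨fun N hN => (key N hN).1, ?_⟩
  have hlim : Filter.Tendsto (fun N : ℕ => (NoncollidingBM.corrMatrix N
      (fun a : (m : Fin (M + 1)) × Fin (n m) => (N : ℝ) + 2 * s a.1) (fun a => x a.1 a.2)).det)
      Filter.atTop (nhds (Matrix.det (Matrix.of fun a b : (Σ m : Fin (M + 1), Fin (n m)) =>
        NoncollidingBM.sineKernel (s a.1) (x a.1 a.2) (s b.1) (x b.1 b.2)))) := by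
    refine ((continuous_id.matrix_det).tendsto _).comp ?_
    refine tendsto_pi_nhds.2 fun a => tendsto_pi_nhds.2 fun b => ?_
    exact NoncollidingBM.tendsto_corrKernel (hs' b.1) (hs' a.1) (x b.1 b.2) (x a.1 a.2)
  refine hlim.congr' ?_
  filter_upwards [Filter.eventually_ge_atTop (∑ m, n m)] with N hN
  exact (key N fun m => (Finset.single_le_sum (fun i _ => Nat.zero_le (n i))
    (Finset.mem_univ m)).trans hN).2.symm
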